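/- Let $A\in\mathbb R^{m\times n}$, $b\in\mathbb R^m$, $B\subseteq[n]$, $C\in\mathbb S^{n+1}$, let $\mathcal P\subseteq\mathbb S^{n+1}$ be a polyhedral convex cone with dual cone $\mathcal P^*$, let $\langle X,Y\rangle=\operatorname{Tr}(XY^\top)$, let $\|\cdot\|$ be the Frobenius norm and $\Pi_S$ the metric projection onto $S$. Put $$\mathcal F=\Big\{\begin{pmatrix}1&x^\top\\x&X\end{pmatrix}\in\mathbb S^{n+1}: Ax=b,\ AX=bx^\top,\ x_i=X_{ii}\ \forall i\in B\Big\},\qquad \mathcal M=\mathcal F\cap\mathbb S^{n+1}_+ ,$$ and consider $$\text{(P)}\qquad \min\{\langle C,Y\rangle : Y-Z=0,\ Y\in\mathcal M,\ Z\in\mathcal P\}$$ and its dual $\text{(D)}\ \max_{W,S_1,S_2\in\mathbb S^{n+1}}\{-p^*(S_1,S_2): C+S_1-W=0,\ S_2+W=0\}$, where $p^*$ is the support function of $\mathcal M\times\mathcal P$. Let $\Omega_D$ be the set of optimal solutions of (D) (with finite objective value). For an integer $r\ge1$ let $$\mathcal M_r=\{R\in\mathbb R^{n\times r}: AR=be_1^\top,\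 (RR^\top)_{ii}=(Re_1)_i\ \forall i\in B\},\qquad \widehat R=\begin{pmatrix}e_1^\top\\R\end{pmatrix}.$$ Let $\sigma_k>0$ be nondecreasing, $r_k\ge1$ integers, $W^0\in\mathcal P^*$, and put $\phi_k(Y)=\langle C,Y\rangle+\frac{\sigma_k}{2}\|\Pi_{\mathcal P^*}(\sigma_k^{-1}W^k-Y)\|^2$, $f_{r_k}(R)=\phi_k(\widehat R\widehat R^\top)$. Let $(Y^{k},Z^{k},W^{k})$ be generated for $k=0,1,2,\dots$ by $$R^{k+1}\in\mathcal M_{r_k},\quad Y^{k+1}=\widehat R^{k+1}(\widehat R^{k+1})^\top,\quad Z^{k+1}=\Pi_{\mathcal P}(Y^{k+1}-\sigma_k^{-1}W^k),\quad W^{k+1}=W^k-\sigma_k(Y^{k+1}-Z^{k+1}),$$ where $R^{k+1}$ satisfies the criterion $$\text{(C1)}\qquad f_{r_k}(R^{k+1})-\inf_{R\in\mathcal M_{r_k}}f_{r_k}(R)\le\frac{\epsilon_k^2}{2\sigma_k},\qquad \epsilon_k\ge0,\quad \sum_{k=0}^\infty\epsilon_k<\infty .$$ Assume that each rank bound $r_k$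 is large enough that the infimum of $\phi_k$ over $\mathcal M$ equals its infimum over the matrices in $\mathcal M$ of rank at most $r_k$ (this holds, for example, if $\phi_k$ has a minimizer over $\mathcal M$ of rank at most $r_k$, or if $r_k\ge n+1$). Theorem. Assume that (P) has an optimal solution and that $\Omega_D$ is nonempty. Then: (i) $W^k$ converges to some $W^*$ that is the $W$-component of an element $(W^*,S_1^*,S_2^*)$ of $\Omega_D$. (ii) $\|Y^{k+1}-Z^{k+1}\|=\frac1{\sigma_k}\|W^{k+1}-W^k\|$ for all $k\ge0$, and $\|Y^k-Z^k\|\to0$. (iii) For all $k\ge0$, $f_{r_k}$ is bounded below on $\mathcal M_{r_k}$ and $$\langle C,Y^{k+1}\rangle-\inf(\mathrm P)\le f_{r_k}(R^{k+1})-\inf_{R\in\mathcal M_{r_k}}f_{r_k}(R)+\frac1{2\sigma_k}\big(\|W^k\|^2-\|W^{k+1}\|^2\big).$$ (iv) If, moreover, the set of optimal solutions of (P) is bounded, then the sequence $(Y^k,Z^k)$ is bounded and all its accumulation points are optimal solutions of (P). -/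

import Mathlib

open Filter Topology

noncomputable section

namespace ALM

/-- The real square matrices of order `n + 1`; the row and column `0` carry the blocks
`Y₁₁`, `Y₁₂`, `Y₂₁`, and the indices `i.succ` the block `Y₂₂`.  The space `𝕊ⁿ⁺¹` consists of the
elements `X` with `X.IsSymm`. -/
abbrev Mat (n : ℕ) : Type := Matrix (Fin (n + 1)) (Fin (n + 1)) ℝ

variable {m n : ℕ}

/-- The trace inner product `⟨X, Y⟩ = Tr (X Yᵀ)`. -/
def inner (X Y : Mat n) : ℝ := (X * Y.transpose).trace

/-- The Frobenius norm. -/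
def norm (X : Mat n) : ℝ := Real.sqrt (inner X X)

/-- A polyhedral convex cone in `𝕊ⁿ⁺¹`: finitely many homogeneous linear inequalities. -/
def IsPolyhedralCone (P : Set (Mat n)) : Prop :=
  ∃ (N : ℕ) (H : Fin N → Mat n), (∀ i, (H i).IsSymm) ∧
    P = {X | X.IsSymm ∧ ∀ i, 0 ≤ inner (H i) X}

/-- The dual cone in `𝕊ⁿ⁺¹`. -/
def dualCone (P : Set (Mat n)) : Set (Mat n) :=
  {W | W.IsSymm ∧ ∀ X ∈ P, 0 ≤ inner W X}

open Classical in
/-- The metric projection onto `S` in the Frobenius norm (for `S` closed, convex and nonempty,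
the nearest point exists and is unique; the default value `0` is then never used). -/
def proj (S : Set (Mat n)) (X : Mat n) : Mat n :=
  if h : ∃ Y ∈ S, ∀ Y' ∈ S, norm (X - Y) ≤ norm (X - Y') then h.choose else 0

/-- The lower left block `x = Y₂₁` of `Y = [Y₁₁, xᵀ; x, X]`. -/
def blockVec (Y : Mat n) : Fin n → ℝ := fun i => Y i.succ 0

/-- The lower right block `X = Y₂₂` of `Y = [Y₁₁, xᵀ; x, X]`. -/
def blockMat (Y : Mat n) : Matrix (Fin n) (Fin n) ℝ := Matrix.of fun i j => Y i.succ j.succ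

/-- The affine set `𝓕` of all `[1, xᵀ; x, X] ∈ 𝕊ⁿ⁺¹` with `A x = b`, `A X = b xᵀ` and
`x_i = X_ii` for `i ∈ B`. -/
def affineSet (A : Matrix (Fin m) (Fin n) ℝ) (b : Fin m → ℝ) (B : Finset (Fin n)) :
    Set (Mat n) :=
  {Y | Y.IsSymm ∧ Y 0 0 = 1 ∧ A.mulVec (blockVec Y) = b ∧
    A * blockMat Y = Matrix.vecMulVec b (blockVec Y) ∧ ∀ i ∈ B, blockVec Y i = blockMat Y i i}

/-- `𝓜 = 𝓕 ∩ 𝕊₊ⁿ⁺¹`. -/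
def feasM (A : Matrix (Fin m) (Fin n) ℝ) (b : Fin m → ℝ) (B : Finset (Fin n)) : Set (Mat n) :=
  {Y | Y ∈ affineSet A b B ∧ Y.PosSemidef}

/-- Feasible pairs of `min {⟨C, Y⟩ : Y - Z = 0, Y ∈ 𝓜, Z ∈ 𝓟}`. -/
def primalFeasible (A : Matrix (Fin m) (Fin n) ℝ) (b : Fin m → ℝ) (B : Finset (Fin n))
    (P : Set (Mat n)) : Set (Mat n × Mat n) :=
  {p | p.1 ∈ feasM A b B ∧ p.2 ∈ P ∧ p.1 - p.2 = 0}

/-- The set of optimal solutions `(Y, Z)` of the primal problem. -/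
def primalSolutions (C : Mat n) (A : Matrix (Fin m) (Fin n) ℝ) (b : Fin m → ℝ)
    (B : Finset (Fin n)) (P : Set (Mat n)) : Set (Mat n × Mat n) :=
  {p | p ∈ primalFeasible A b B P ∧ ∀ q ∈ primalFeasible A b B P, inner C p.1 ≤ inner C q.1}

/-- The optimal value of the primal problem (a minimum when there is an optimal solution). -/
def primalValue (C : Mat n) (A : Matrix (Fin m) (Fin n) ℝ) (b : Fin m → ℝ)
    (B : Finset (Fin n)) (P : Set (Mat n)) : ℝ :=
  sInf ((fun p : Mat n × Mat n => inner C p.1) '' primalFeasible A b B P)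

/-- The conjugate `p*` of the indicator function `p` of `𝓜 × 𝓟`, that is, the support function of
`𝓜 × 𝓟`, with values in the extended reals. -/
def supportFn (A : Matrix (Fin m) (Fin n) ℝ) (b : Fin m → ℝ) (B : Finset (Fin n))
    (P : Set (Mat n)) (S₁ S₂ : Mat n) : EReal :=
  ⨆ Y ∈ feasM A b B, ⨆ Z ∈ P, ((inner S₁ Y + inner S₂ Z : ℝ) : EReal)

/-- Feasible triples `(W, S₁, S₂)` of the dual problem
`max {-p*(S₁, S₂) : C + S₁ - W = 0, S₂ + W = 0}`, with a finite objective value. -/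
def dualFeasible (C : Mat n) (A : Matrix (Fin m) (Fin n) ℝ) (b : Fin m → ℝ)
    (B : Finset (Fin n)) (P : Set (Mat n)) : Set (Mat n × Mat n × Mat n) :=
  {t | t.1.IsSymm ∧ t.2.1.IsSymm ∧ t.2.2.IsSymm ∧ C + t.2.1 - t.1 = 0 ∧ t.2.2 + t.1 = 0 ∧
    supportFn A b B P t.2.1 t.2.2 ≠ ⊤}

/-- The set `Ω_D` of optimal solutions `(W, S₁, S₂)` of the dual problem. -/
def dualSolutions (C : Mat n) (A : Matrix (Fin m) (Fin n) ℝ) (b : Fin m → ℝ)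
    (B : Finset (Fin n)) (P : Set (Mat n)) : Set (Mat n × Mat n × Mat n) :=
  {t | t ∈ dualFeasible C A b B P ∧ ∀ t' ∈ dualFeasible C A b B P,
    -supportFn A b B P t'.2.1 t'.2.2 ≤ -supportFn A b B P t.2.1 t.2.2}

/-- The objective `φ(Y) = ⟨C, Y⟩ + (σ/2) ‖Π_{𝓟*}(σ⁻¹ W - Y)‖²` of the convex subproblem
`min {φ(Y) : Y ∈ 𝓜}`. -/
def phi (C : Mat n) (P : Set (Mat n)) (σ : ℝ) (W Y : Mat n) : ℝ :=
  inner C Y + σ / 2 * norm (proj (dualCone P) (σ⁻¹ • W - Y)) ^ 2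

/-- The first standard unit vector `e₁` of `ℝʳ`. -/
def e₁ (r : ℕ) : Fin r → ℝ := fun j => if j.val = 0 then 1 else 0

/-- `R̂ = [e₁ᵀ; R]`. -/
def hat {r : ℕ} (R : Matrix (Fin n) (Fin r) ℝ) : Matrix (Fin (n + 1)) (Fin r) ℝ :=
  Matrix.of (Fin.cons (e₁ r) fun i => R i)

/-- `𝓜_r = {R ∈ ℝⁿˣʳ : A R = b e₁ᵀ, diag_B (R Rᵀ) = R_B e₁}`. -/
def feasR (A : Matrix (Fin m) (Fin n) ℝ) (b : Fin m → ℝ) (B : Finset (Fin n)) (r : ℕ) :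
    Set (Matrix (Fin n) (Fin r) ℝ) :=
  {R | A * R = Matrix.vecMulVec b (e₁ r) ∧ ∀ i ∈ B, (R * R.transpose) i i = R.mulVec (e₁ r) i}

/-- The objective `f_r(R) = φ(R̂ R̂ᵀ)` of the factorized subproblem `min {f_r(R) : R ∈ 𝓜_r}`. -/
def fR (C : Mat n) (P : Set (Mat n)) (σ : ℝ) (W : Mat n) {r : ℕ}
    (R : Matrix (Fin n) (Fin r) ℝ) : ℝ :=
  phi C P σ W (hat R * (hat R).transpose)

/-- The error `f_r(R) - inf_{R' ∈ 𝓜_r} f_r(R')` of the factorized subproblem at `R`. -/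
def subproblemGap (C : Mat n) (A : Matrix (Fin m) (Fin n) ℝ) (b : Fin m → ℝ)
    (B : Finset (Fin n)) (P : Set (Mat n)) (σ : ℝ) (W : Mat n) {r : ℕ}
    (R : Matrix (Fin n) (Fin r) ℝ) : ℝ :=
  fR C P σ W R - sInf ((fun R' => fR C P σ W R') '' feasR A b B r)

/-- The rank bound `r` does not change the infimum of the convex subproblem: every value of `φ` on
`𝓜` is attained, up to an arbitrarily small error, by a matrix in `𝓜` of rank at most `r`. -/
def RankAdequate (C : Mat n) (A : Matrix (Fin m) (Fin n) ℝ) (b : Fin m → ℝ)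
    (B : Finset (Fin n)) (P : Set (Mat n)) (σ : ℝ) (W : Mat n) (r : ℕ) : Prop :=
  ∀ Y ∈ feasM A b B, ∀ δ > 0, ∃ Y' ∈ feasM A b B, Y'.rank ≤ r ∧
    phi C P σ W Y' ≤ phi C P σ W Y + δ

/-- `(Y, Z, W)` is generated by the augmented Lagrangian method with penalty parameters `σ` and
rank bounds `r`.  Here `R k ∈ ℝ^{n × r_k}` is the point obtained in step `k`, which is written
`R^{k+1}` in the usual notation; `Y 0` and `Z 0` play no role. -/
structure IsALMSequence (A : Matrix (Fin m) (Fin n) ℝ) (b : Fin m → ℝ)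
    (B : Finset (Fin n)) (P : Set (Mat n)) (σ : ℕ → ℝ) (r : ℕ → ℕ)
    (R : (k : ℕ) → Matrix (Fin n) (Fin (r k)) ℝ) (Y Z W : ℕ → Mat n) : Prop where
  penalty_pos : ∀ k, 0 < σ k
  penalty_mono : Monotone σ
  rank_pos : ∀ k, 1 ≤ r k
  multiplier_zero : W 0 ∈ dualCone P
  point_mem : ∀ k, R k ∈ feasR A b B (r k)
  Y_step : ∀ k, Y (k + 1) = hat (R k) * (hat (R k)).transpose
  Z_step : ∀ k, Z (k + 1) = proj P (Y (k + 1) - (σ k)⁻¹ • W k)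
  W_step : ∀ k, W (k + 1) = W k - σ k • (Y (k + 1) - Z (k + 1))

/-- The inexactness criterion (C1):
`f_{r_k}(R^{k+1}) - inf_{𝓜_{r_k}} f_{r_k} ≤ ε_k² / (2 σ_k)`, `ε_k ≥ 0`, `∑ ε_k < ∞`. -/
structure CriterionC1 (C : Mat n) (A : Matrix (Fin m) (Fin n) ℝ) (b : Fin m → ℝ)
    (B : Finset (Fin n)) (P : Set (Mat n)) (σ ε : ℕ → ℝ) (r : ℕ → ℕ)
    (R : (k : ℕ) → Matrix (Fin n) (Fin (r k)) ℝ) (W : ℕ → Mat n) : Prop where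
  tol_nonneg : ∀ k, 0 ≤ ε k
  tol_summable : Summable ε
  gap_le : ∀ k, subproblemGap C A b B P (σ k) (W k) (R k) ≤ ε k ^ 2 / (2 * σ k)

/-- A bounded set of pairs of matrices. -/
def IsBoundedPairs (S : Set (Mat n × Mat n)) : Prop :=
  ∃ K : ℝ, ∀ p ∈ S, norm p.1 ≤ K ∧ norm p.2 ≤ K

end ALM

end

/-! The multiplier iteration is an inexact proximal point method for the concave dual function `g(U)
= inf_{Y ∈ M} ⟨C - U, Y⟩` on the dual cone `K` of `P`. For fixed `Y`, the value `φ_k(Y)` is the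
maximum over `U ∈ K` of a function affine in `Y` and strongly concave in `U` (`proxLagrangian`), and
the maximizer is the updated multiplier.

Strong concavity makes the multipliers of any minimizing sequence of `φ_k` Cauchy. Their limit `V`
is the exact proximal point of `g` at `W^k`, whether or not `φ_k` attains its infimum
(`exists_proximal_point`). The same estimate turns a gap `ε_k² / (2σ_k)` into `‖W^{k+1} - V‖ ≤ ε_k`,
so summable errors and Fejér monotonicity with respect to the dual solutions give convergence
(`tendsto_inexact_proximal_point`).

The factorized problem enters only through its infimum, which equals that of `φ_k` over `M`: a
matrix in `M` of rank at most `r` is a Gram matrix whose vectors can be reflected so that the first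
one is `e₁` (`exists_hat_eq`).

The objective estimate compares `Y^{k+1}` with a primal solution, at which the multiplier step
cannot increase the norm of `W^k`. Boundedness of the iterates is a recession argument: an unbounded
sequence would yield a common recession direction of `M` and `P` along which the cost does not
increase, hence unboundedly many solutions. -/

namespace ProximalPoint

open scoped RealInnerProductSpace

variable {E : Type*} [NormedAddCommGroup E] [InnerProductSpace ℝ E]

/-! ### The proximal Lagrangian and its maximization over the cone. -/

/-- The variational characterization of `w` as the metric projection of `x` onto the convex
cone `K`. -/
structure IsConeProj (K : Set E) (x w : E) : Prop where
  mem : w ∈ K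
  inner_self_eq_zero : ⟪x - w, w⟫ = 0
  inner_le_zero : ∀ u ∈ K, ⟪x - w, u⟫ ≤ 0

/-- The proximal Lagrangian `⟨C - U, Y⟩ - (‖U - W‖² - ‖W‖²) / (2σ)`. -/
noncomputable def proxLagrangian (C W : E) (σ : ℝ) (Y U : E) : ℝ :=
  ⟪C - U, Y⟫ - (‖U - W‖ ^ 2 - ‖W‖ ^ 2) / (2 * σ)

variable {C W : E} {σ : ℝ} {M K : Set E}

/-- Completing the square, `proxLagrangian` is a constant minus `‖U - (W - σ • Y)‖² / (2σ)`, so `w`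
maximizes it over `K`. The quadratic term records strong concavity, the source of every later
distance estimate. -/
theorem proxLagrangian_add_le (hσ : 0 < σ) {Y U w : E} (h : IsConeProj K (W - σ • Y) w)
    (hU : U ∈ K) :
    proxLagrangian C W σ Y U + ‖U - w‖ ^ 2 / (2 * σ) ≤ ⟪C, Y⟫ + ‖w‖ ^ 2 / (2 * σ) := by
  have h1 := h.inner_le_zero U hU
  have e : ⟪C, Y⟫ + ‖w‖ ^ 2 / (2 * σ) -
      (proxLagrangian C W σ Y U + ‖U - w‖ ^ 2 / (2 * σ)) = -⟪W - σ • Y - w, U⟫ / σ := by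
    rw [proxLagrangian, norm_sub_sq_real, norm_sub_sq_real]
    simp only [inner_sub_left, inner_smul_left, RCLike.conj_to_real]
    rw [real_inner_comm W U, real_inner_comm w U, real_inner_comm Y U]
    field_simp
    ring
  have : 0 ≤ -⟪W - σ • Y - w, U⟫ / σ := div_nonneg (by linarith) hσ.le
  linarith

theorem proxLagrangian_coneProj (hσ : 0 < σ) {Y w : E} (h : IsConeProj K (W - σ • Y) w) :
    proxLagrangian C W σ Y w = ⟪C, Y⟫ + ‖w‖ ^ 2 / (2 * σ) := by
  have h1 := h.inner_self_eq_zero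
  have e : ⟪C, Y⟫ + ‖w‖ ^ 2 / (2 * σ) - proxLagrangian C W σ Y w
      = -⟪W - σ • Y - w, w⟫ / σ := by
    rw [proxLagrangian, norm_sub_sq_real]
    simp only [inner_sub_left, inner_smul_left, RCLike.conj_to_real, real_inner_self_eq_norm_sq]
    rw [real_inner_comm W w, real_inner_comm Y w]
    field_simp
    ring
  rw [h1] at e
  simp only [neg_zero, zero_div] at e
  linarith

theorem proxLagrangian_combo {a b : ℝ} (hab : a + b = 1) (Y₁ Y₂ U : E) :
    proxLagrangian C W σ (a • Y₁ + b • Y₂) U =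
      a * proxLagrangian C W σ Y₁ U + b * proxLagrangian C W σ Y₂ U := by
  obtain rfl : b = 1 - a := by linarith
  simp only [proxLagrangian, inner_add_right, inner_smul_right]
  ring

theorem continuous_proxLagrangian (Y : E) : Continuous (proxLagrangian C W σ Y) := by
  unfold proxLagrangian
  fun_prop

/-! ### Existence of the exact proximal point without primal attainment. -/

section Saddle

variable {w : E → E} {μ : ℝ}

/-- Compare with the midpoint `Y`: its value is at least `μ` and, by affinity, is the average of the
Lagrangians at `Y₁`, `Y₂` with multiplier `w Y`. Each falls short of the value at `Yᵢ` by `‖w Y - w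
Yᵢ‖² / (2σ)`; the parallelogram law then bounds `‖w Y₁ - w Y₂‖`. -/
theorem coneProj_norm_sub_sq_le (hσ : 0 < σ) (hM : Convex ℝ M)
    (hw : ∀ Y ∈ M, IsConeProj K (W - σ • Y) (w Y))
    (hμ : ∀ Y ∈ M, μ ≤ ⟪C, Y⟫ + ‖w Y‖ ^ 2 / (2 * σ)) {δ : ℝ} {Y₁ Y₂ : E} (h₁ : Y₁ ∈ M)
    (h₂ : Y₂ ∈ M) (hδ₁ : ⟪C, Y₁⟫ + ‖w Y₁‖ ^ 2 / (2 * σ) ≤ μ + δ)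
    (hδ₂ : ⟪C, Y₂⟫ + ‖w Y₂‖ ^ 2 / (2 * σ) ≤ μ + δ) :
    ‖w Y₁ - w Y₂‖ ^ 2 ≤ 8 * σ * δ := by
  have hY : (1 / 2 : ℝ) • Y₁ + (1 / 2 : ℝ) • Y₂ ∈ M :=
    hM h₁ h₂ (by norm_num) (by norm_num) (by norm_num)
  set Y := (1 / 2 : ℝ) • Y₁ + (1 / 2 : ℝ) • Y₂ with hYdef
  have e : proxLagrangian C W σ Y (w Y) = _ :=
    proxLagrangian_combo (by norm_num) Y₁ Y₂ (w Y)
  rw [proxLagrangian_coneProj hσ (hw Y hY)] at e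
  have i₁ := proxLagrangian_add_le (C := C) hσ (hw Y₁ h₁) (hw Y hY).mem
  have i₂ := proxLagrangian_add_le (C := C) hσ (hw Y₂ h₂) (hw Y hY).mem
  have i₀ := hμ Y hY
  have hs : ‖w Y - w Y₁‖ ^ 2 / (2 * σ) + ‖w Y - w Y₂‖ ^ 2 / (2 * σ) ≤ 2 * δ := by linarith
  rw [← add_div, div_le_iff₀ (by positivity)] at hs
  have hp := parallelogram_law_with_norm ℝ (w Y - w Y₁) (w Y - w Y₂)
  have hsub : w Y - w Y₁ - (w Y - w Y₂) = -(w Y₁ - w Y₂) := by abel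
  rw [hsub, norm_neg] at hp
  nlinarith [sq_nonneg ‖w Y - w Y₁ + (w Y - w Y₂)‖]

/-- Approximate minimizers of the augmented Lagrangian determine the exact proximal point. -/
theorem exists_proximal_point [CompleteSpace E] (hσ : 0 < σ) (hM : Convex ℝ M) (hK : IsClosed K)
    (hw : ∀ Y ∈ M, IsConeProj K (W - σ • Y) (w Y))
    (hμ : ∀ Y ∈ M, μ ≤ ⟪C, Y⟫ + ‖w Y‖ ^ 2 / (2 * σ))
    (hμ' : ∀ δ > 0, ∃ Y ∈ M, ⟪C, Y⟫ + ‖w Y‖ ^ 2 / (2 * σ) ≤ μ + δ) :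
    ∃ V ∈ K, (∀ Y ∈ M, μ ≤ proxLagrangian C W σ Y V) ∧
      ∀ U ∈ K, ∀ c : ℝ, (∀ Y ∈ M, c ≤ ⟪C - U, Y⟫) →
        c - (‖U - W‖ ^ 2 - ‖W‖ ^ 2) / (2 * σ) + ‖U - V‖ ^ 2 / (2 * σ) ≤ μ := by
  let t : ℕ → ℝ := fun j => 1 / ((j : ℝ) + 1)
  have ht0 : ∀ j, 0 < t j := fun j => by positivity
  have ht1 : ∀ j, t j ≤ 1 := fun j => by
    simp only [t]
    rw [div_le_one (by positivity)]
    linarith [(Nat.cast_nonneg j : (0 : ℝ) ≤ j)]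
  have htanti : Antitone t := fun i j hij => one_div_le_one_div_of_le (by positivity) (by gcongr)
  have htlim : Tendsto t atTop (𝓝 0) := tendsto_one_div_add_atTop_nhds_zero_nat
  -- The accuracy `t j ^ 2` is of smaller order than the step `t j` taken below from `y j` towards
  -- `Y`, so it still vanishes after division by `t j`.
  choose y hyM hy using fun j => hμ' (t j ^ 2) (by have := ht0 j; positivity)
  have hlim0 : Tendsto (fun N => √(8 * σ * t N ^ 2)) atTop (𝓝 0) := by
    have : Tendsto (fun N => √(8 * σ * t N ^ 2)) atTop (𝓝 √(8 * σ * 0 ^ 2)) :=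
      ((htlim.pow 2).const_mul _).sqrt
    simpa using this
  have hc : CauchySeq fun j => w (y j) := by
    refine cauchySeq_of_le_tendsto_0 _ (fun i j N hi hj => ?_) hlim0
    rw [dist_eq_norm]
    refine Real.le_sqrt_of_sq_le
      (coneProj_norm_sub_sq_le hσ hM hw hμ (hyM i) (hyM j) ((hy i).trans ?_) ((hy j).trans ?_))
    · have := pow_le_pow_left₀ (ht0 i).le (htanti hi) 2
      linarith
    · have := pow_le_pow_left₀ (ht0 j).le (htanti hj) 2
      linarith
  obtain ⟨V, hV⟩ := cauchySeq_tendsto_of_complete hc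
  refine ⟨V, hK.mem_of_tendsto hV (Eventually.of_forall fun j => (hw _ (hyM j)).mem), ?_, ?_⟩
  · intro Y hY
    set d := ⟪C, Y⟫ + ‖w Y‖ ^ 2 / (2 * σ) - μ with hd
    have hd0 : 0 ≤ d := by linarith [hμ Y hY]
    have hYt : ∀ j, (1 - t j) • y j + t j • Y ∈ M := fun j =>
      hM (hyM j) hY (by linarith [ht1 j]) (ht0 j).le (by ring)
    set q : ℕ → E := fun j => w ((1 - t j) • y j + t j • Y) with hq
    have key : ∀ j, ⟪C, (1 - t j) • y j + t j • Y⟫ + ‖q j‖ ^ 2 / (2 * σ) =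
        (1 - t j) * proxLagrangian C W σ (y j) (q j) + t j * proxLagrangian C W σ Y (q j) := by
      intro j
      rw [← proxLagrangian_combo (by ring), ← proxLagrangian_coneProj hσ (hw _ (hYt j))]
    have hlag : ∀ j, proxLagrangian C W σ (y j) (q j) ≤ μ + t j ^ 2 := by
      intro j
      have i := proxLagrangian_add_le (C := C) hσ (hw _ (hyM j)) (hw _ (hYt j)).mem
      have : 0 ≤ ‖w ((1 - t j) • y j + t j • Y) - w (y j)‖ ^ 2 / (2 * σ) := by positivity
      linarith [hy j]
    have hlagY : ∀ j, proxLagrangian C W σ Y (q j) ≤ μ + d := by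
      intro j
      have i := proxLagrangian_add_le (C := C) hσ (hw _ hY) (hw _ (hYt j)).mem
      have : 0 ≤ ‖w ((1 - t j) • y j + t j • Y) - w Y‖ ^ 2 / (2 * σ) := by positivity
      linarith
    have hqy : ∀ j, ‖q j - w (y j)‖ ≤ √(8 * σ * (t j ^ 2 + t j * d)) := by
      intro j
      refine Real.le_sqrt_of_sq_le
        (coneProj_norm_sub_sq_le hσ hM hw hμ (hYt j) (hyM j) ?_ ((hy j).trans ?_))
      · refine (key j).trans_le ?_
        nlinarith [mul_le_mul_of_nonneg_left (hlag j) (sub_nonneg.2 (ht1 j)),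
          mul_le_mul_of_nonneg_left (hlagY j) (ht0 j).le, mul_nonneg (ht0 j).le (sq_nonneg (t j))]
      · nlinarith [mul_nonneg (ht0 j).le hd0]
    have hlim1 : Tendsto (fun j => √(8 * σ * (t j ^ 2 + t j * d))) atTop (𝓝 0) := by
      have : Tendsto (fun j => √(8 * σ * (t j ^ 2 + t j * d))) atTop
          (𝓝 √(8 * σ * (0 ^ 2 + 0 * d))) :=
        (((htlim.pow 2).add (htlim.mul_const d)).const_mul _).sqrt
      simpa using this
    have hqV : Tendsto q atTop (𝓝 V) := by
      have := (squeeze_zero_norm hqy hlim1).add hV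
      simpa using this
    -- First-order optimality: the value at the perturbed point is at least `μ`, the part coming
    -- from `y j` is at most `μ + t j ^ 2`, and dividing by `t j` leaves a bound for `Y` alone.
    have hfin : ∀ j, μ - t j ≤ proxLagrangian C W σ Y (q j) := by
      intro j
      have i := hμ _ (hYt j)
      have i' : μ ≤ _ := i.trans_eq (key j)
      have i2 := mul_le_mul_of_nonneg_left (hlag j) (sub_nonneg.2 (ht1 j))
      have : 0 ≤ t j * (proxLagrangian C W σ Y (q j) - (μ - t j)) := by
        nlinarith [mul_nonneg (ht0 j).le (sq_nonneg (t j))]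
      linarith [nonneg_of_mul_nonneg_right this (ht0 j)]
    have l1 : Tendsto (fun j => μ - t j) atTop (𝓝 (μ - 0)) := tendsto_const_nhds.sub htlim
    rw [sub_zero] at l1
    exact le_of_tendsto_of_tendsto' l1 (((continuous_proxLagrangian Y).tendsto V).comp hqV) hfin
  · intro U hU c hcU
    have l1 : Tendsto (fun j => c - (‖U - W‖ ^ 2 - ‖W‖ ^ 2) / (2 * σ) +
        ‖U - w (y j)‖ ^ 2 / (2 * σ)) atTop
        (𝓝 (c - (‖U - W‖ ^ 2 - ‖W‖ ^ 2) / (2 * σ) + ‖U - V‖ ^ 2 / (2 * σ))) :=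
      ((((tendsto_const_nhds.sub hV).norm).pow 2).div_const _).const_add _
    have l2 : Tendsto (fun j => μ + t j ^ 2) atTop (𝓝 (μ + 0 ^ 2)) := (htlim.pow 2).const_add _
    have := le_of_tendsto_of_tendsto' l1 l2 fun j => by
      have i := proxLagrangian_add_le (C := C) hσ (hw _ (hyM j)) hU
      have := hcU _ (hyM j)
      rw [proxLagrangian] at i
      linarith [hy j]
    simpa using this

end Saddle

/-- The inequalities satisfied by a proximal point of the dual function relative to a
maximizer `U` with maximal value `γ`. -/
theorem proximal_point_estimates (hσ : 0 < σ) {V U : E} {μ γ : ℝ} (hV : V ∈ K)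
    (hlag : ∀ Y ∈ M, μ ≤ proxLagrangian C W σ Y V)
    (hμ : ∀ U ∈ K, ∀ c : ℝ, (∀ Y ∈ M, c ≤ ⟪C - U, Y⟫) →
        c - (‖U - W‖ ^ 2 - ‖W‖ ^ 2) / (2 * σ) + ‖U - V‖ ^ 2 / (2 * σ) ≤ μ)
    (hγ : ∀ U ∈ K, ∀ c : ℝ, (∀ Y ∈ M, c ≤ ⟪C - U, Y⟫) → c ≤ γ)
    (hU : U ∈ K) (hUγ : ∀ Y ∈ M, γ ≤ ⟪C - U, Y⟫) :
    ‖U - V‖ ^ 2 + ‖V - W‖ ^ 2 ≤ ‖U - W‖ ^ 2 ∧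
      ∀ Y ∈ M, γ - (‖U - W‖ ^ 2 - ‖U - V‖ ^ 2) / (2 * σ) ≤ ⟪C - V, Y⟫ := by
  have h1 := hμ U hU γ hUγ
  have h2 : ∀ Y ∈ M, μ + (‖V - W‖ ^ 2 - ‖W‖ ^ 2) / (2 * σ) ≤ ⟪C - V, Y⟫ := fun Y hY => by
    have := hlag Y hY
    rw [proxLagrangian] at this
    linarith
  have h3 := hγ V hV _ h2
  have h4 : (‖U - V‖ ^ 2 + ‖V - W‖ ^ 2 - ‖U - W‖ ^ 2) / (2 * σ) ≤ 0 := by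
    have e : (‖U - V‖ ^ 2 + ‖V - W‖ ^ 2 - ‖U - W‖ ^ 2) / (2 * σ) =
      ‖U - V‖ ^ 2 / (2 * σ) + (‖V - W‖ ^ 2 - ‖W‖ ^ 2) / (2 * σ)
        - (‖U - W‖ ^ 2 - ‖W‖ ^ 2) / (2 * σ) := by ring
    linarith
  refine ⟨?_, fun Y hY => ?_⟩
  · rw [div_le_iff₀ (by positivity)] at h4
    linarith
  · have h5 := h2 Y hY
    have h6 : 0 ≤ ‖V - W‖ ^ 2 / (2 * σ) := by positivity
    have e : (‖U - W‖ ^ 2 - ‖U - V‖ ^ 2) / (2 * σ) + (‖V - W‖ ^ 2 - ‖W‖ ^ 2) / (2 * σ) =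
      (‖U - W‖ ^ 2 - ‖W‖ ^ 2) / (2 * σ) - ‖U - V‖ ^ 2 / (2 * σ) + ‖V - W‖ ^ 2 / (2 * σ) := by
      ring
    linarith

/-! ### Convergence of the inexact proximal point method. -/

/-- A nonnegative sequence that increases by summable amounts only converges. -/
theorem exists_tendsto_of_le_add_summable {a ε : ℕ → ℝ} (ha : ∀ k, 0 ≤ a k) (hε : ∀ k, 0 ≤ ε k)
    (hs : Summable ε) (h : ∀ k, a (k + 1) ≤ a k + ε k) : ∃ l, Tendsto a atTop (𝓝 l) := by
  have hanti : Antitone fun k => a k - ∑ i ∈ Finset.range k, ε i := by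
    refine antitone_nat_of_succ_le fun k => ?_
    rw [Finset.sum_range_succ]
    linarith [h k]
  have hb : BddBelow (Set.range fun k => a k - ∑ i ∈ Finset.range k, ε i) := by
    refine ⟨-∑' i, ε i, ?_⟩
    rintro _ ⟨k, rfl⟩
    have := hs.sum_le_tsum (Finset.range k) fun i _ => hε i
    simp only
    linarith [ha k]
  have := (tendsto_atTop_ciInf hanti hb).add hs.hasSum.tendsto_sum_nat
  simp only [sub_add_cancel] at this
  exact ⟨_, this⟩

/-- Convergence of the inexact proximal point iteration. -/
theorem tendsto_inexact_proximal_point [ProperSpace E] (hK : IsClosed K) {W V : ℕ → E}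
    {σ ε : ℕ → ℝ} {σ₀ γ : ℝ} (hσ₀ : 0 < σ₀) (hσ : ∀ k, σ₀ ≤ σ k) (hε : ∀ k, 0 ≤ ε k)
    (hs : Summable ε) (hV : ∀ k, V k ∈ K) (hWV : ∀ k, ‖W (k + 1) - V k‖ ≤ ε k)
    (hne : ∃ U ∈ K, ∀ Y ∈ M, γ ≤ ⟪C - U, Y⟫)
    (hstep : ∀ U ∈ K, (∀ Y ∈ M, γ ≤ ⟪C - U, Y⟫) → ∀ k,
      ‖U - V k‖ ^ 2 + ‖V k - W k‖ ^ 2 ≤ ‖U - W k‖ ^ 2 ∧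
      ∀ Y ∈ M, γ - (‖U - W k‖ ^ 2 - ‖U - V k‖ ^ 2) / (2 * σ k) ≤ ⟪C - V k, Y⟫) :
    (∃ U ∈ K, (∀ Y ∈ M, γ ≤ ⟪C - U, Y⟫) ∧ Tendsto W atTop (𝓝 U)) := by
  have hVW : ∀ U ∈ K, (∀ Y ∈ M, γ ≤ ⟪C - U, Y⟫) → ∀ k, ‖U - V k‖ ≤ ‖U - W k‖ := by
    intro U hU hUγ k
    refine (sq_le_sq₀ (norm_nonneg _) (norm_nonneg _)).1 ?_
    linarith [(hstep U hU hUγ k).1, sq_nonneg ‖V k - W k‖]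
  have hWV' : ∀ (U : E) k, ‖U - W (k + 1)‖ ≤ ‖U - V k‖ + ε k := by
    intro U k
    have h := norm_sub_le_norm_sub_add_norm_sub U (V k) (W (k + 1))
    rw [norm_sub_rev (V k)] at h
    linarith [hWV k]
  have hconv : ∀ U ∈ K, (∀ Y ∈ M, γ ≤ ⟪C - U, Y⟫) → ∃ l, Tendsto (fun k => ‖U - W k‖) atTop (𝓝 l) :=
    fun U hU hUγ => exists_tendsto_of_le_add_summable (fun _ => norm_nonneg _) hε hs fun k =>
      (hWV' U k).trans (by linarith [hVW U hU hUγ k])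
  obtain ⟨U, hU, hUγ⟩ := hne
  obtain ⟨l, hl⟩ := hconv U hU hUγ
  have hε0 := hs.tendsto_atTop_zero
  -- Squeezed between consecutive distances of the `W k` up to `ε k`, the distances of the `V k`
  -- have the same limit, so the dual gap of `V k` tends to zero.
  have hlV : Tendsto (fun k => ‖U - V k‖) atTop (𝓝 l) := by
    refine tendsto_of_tendsto_of_tendsto_of_le_of_le (g := fun k => ‖U - W (k + 1)‖ - ε k) ?_ hl
      (fun k => ?_) (hVW U hU hUγ)
    · simpa using (hl.comp (tendsto_add_atTop_nat 1)).sub hε0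
    · simp only
      linarith [hWV' U k]
  have hdiff : Tendsto (fun k => ‖U - W k‖ ^ 2 - ‖U - V k‖ ^ 2) atTop (𝓝 0) := by
    simpa using (hl.pow 2).sub (hlV.pow 2)
  have hgap : Tendsto (fun k => γ - (‖U - W k‖ ^ 2 - ‖U - V k‖ ^ 2) / (2 * σ k)) atTop (𝓝 γ) := by
    have : Tendsto (fun k => (‖U - W k‖ ^ 2 - ‖U - V k‖ ^ 2) / (2 * σ k)) atTop (𝓝 0) := by
      refine squeeze_zero (g := fun k => (‖U - W k‖ ^ 2 - ‖U - V k‖ ^ 2) / (2 * σ₀))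
        (fun k => ?_) (fun k => ?_) (by simpa using hdiff.div_const (2 * σ₀))
      · have := hσ k
        have h0 : 0 ≤ ‖U - W k‖ ^ 2 - ‖U - V k‖ ^ 2 := by
          linarith [(hstep U hU hUγ k).1, sq_nonneg ‖V k - W k‖]
        exact div_nonneg h0 (by linarith)
      · have h0 : 0 ≤ ‖U - W k‖ ^ 2 - ‖U - V k‖ ^ 2 := by
          linarith [(hstep U hU hUγ k).1, sq_nonneg ‖V k - W k‖]
        exact div_le_div_of_nonneg_left h0 (by positivity) (by linarith [hσ k])
    simpa using this.const_sub γ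
  obtain ⟨b, hb⟩ := hlV.bddAbove_range
  -- A cluster point of `V` is a dual solution, so the distances from `V₀` to `W k` also converge; a
  -- subsequence then identifies their limit as zero.
  obtain ⟨V₀, -, ψ, hψ, hV₀⟩ := (isCompact_closedBall U b).tendsto_subseq (x := V) fun k => by
    rw [mem_closedBall_iff_norm']
    exact hb ⟨k, rfl⟩
  have hV₀K : V₀ ∈ K := hK.mem_of_tendsto hV₀ (Eventually.of_forall fun j => hV _)
  have hV₀γ : ∀ Y ∈ M, γ ≤ ⟪C - V₀, Y⟫ := fun Y hY =>
    le_of_tendsto_of_tendsto' (hgap.comp hψ.tendsto_atTop)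
      ((tendsto_const_nhds.sub hV₀).inner tendsto_const_nhds)
      fun j => (hstep U hU hUγ _).2 Y hY
  refine ⟨V₀, hV₀K, hV₀γ, ?_⟩
  obtain ⟨l₀, hl₀⟩ := hconv V₀ hV₀K hV₀γ
  have h0 : Tendsto (fun j => ‖V₀ - W (ψ j + 1)‖) atTop (𝓝 0) := by
    refine squeeze_zero (fun _ => norm_nonneg _) (fun j => hWV' V₀ (ψ j)) ?_
    have h1 : Tendsto (fun j => ‖V₀ - V (ψ j)‖) atTop (𝓝 0) := by
      simpa using (tendsto_const_nhds (x := V₀)).sub hV₀ |>.norm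
    simpa using h1.add (hε0.comp hψ.tendsto_atTop)
  have : l₀ = 0 := tendsto_nhds_unique
    (hl₀.comp ((tendsto_add_atTop_nat 1).comp hψ.tendsto_atTop)) h0
  rw [this] at hl₀
  rw [tendsto_iff_norm_sub_tendsto_zero]
  simpa only [norm_sub_rev] using hl₀

/-! ### Boundedness by recession directions. -/

/-- If the solution set of `min {⟨C, y⟩ : y ∈ M ∩ P}` is bounded, so is every family of nearly
feasible points with bounded objective values. -/
theorem exists_norm_le_of_bounded_solutions [ProperSpace E] {P : Set E} (hMc : IsClosed M)
    (hM : Convex ℝ M) (hPc : IsClosed P) (hP : Convex ℝ P) {y₀ : E} (hyM : y₀ ∈ M) (hyP : y₀ ∈ P)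
    {L : ℝ} (hL : ∀ y ∈ M, y ∈ P → ⟪C, y⟫ ≤ ⟪C, y₀⟫ → ‖y‖ ≤ L) {ι : Type*} {y z : ι → E} {b : ℝ}
    (hy : ∀ k, y k ∈ M) (hz : ∀ k, z k ∈ P) (hyz : ∀ k, ‖y k - z k‖ ≤ b)
    (hC : ∀ k, ⟪C, y k⟫ ≤ b) : ∃ L', ∀ k, ‖y k‖ ≤ L' := by
  by_contra! hcon
  choose i hi using fun j : ℕ => hcon (‖y₀‖ + (j + 1))
  set n : ℕ → ℝ := fun j => ‖y (i j) - y₀‖ with hn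
  have hnj : ∀ j : ℕ, (j : ℝ) + 1 ≤ n j := fun j => by
    have := norm_sub_norm_le (y (i j)) y₀
    linarith [hi j]
  have hn0 : ∀ j, 0 < n j := fun j => by
    have := hnj j
    have : (0 : ℝ) ≤ j := Nat.cast_nonneg j
    linarith
  have hninf : Tendsto n atTop atTop :=
    tendsto_atTop_mono (fun j => by linarith [hnj j]) tendsto_natCast_atTop_atTop
  have hninv : Tendsto (fun j => (n j)⁻¹) atTop (𝓝 0) := tendsto_inv_atTop_zero.comp hninf
  obtain ⟨D, hD, ψ, hψ, hDlim⟩ := (isCompact_sphere (0 : E) 1).tendsto_subseq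
    (x := fun j => (n j)⁻¹ • (y (i j) - y₀)) fun j => by
      rw [mem_sphere_zero_iff_norm, norm_smul, norm_inv, Real.norm_of_nonneg (hn0 j).le]
      exact inv_mul_cancel₀ (hn0 j).ne'
  rw [mem_sphere_zero_iff_norm] at hD
  have hninv' : Tendsto (fun j => (n (ψ j))⁻¹) atTop (𝓝 0) := hninv.comp hψ.tendsto_atTop
  have hzlim : Tendsto (fun j => (n (ψ j))⁻¹ • (z (i (ψ j)) - y₀)) atTop (𝓝 D) := by
    have h0 : Tendsto (fun j => (n (ψ j))⁻¹ • (y (i (ψ j)) - z (i (ψ j)))) atTop (𝓝 0) := by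
      refine squeeze_zero_norm (a := fun j => (n (ψ j))⁻¹ * b) (fun j => ?_)
        (by simpa using hninv'.mul_const b)
      rw [norm_smul, norm_inv, Real.norm_of_nonneg (hn0 _).le]
      exact mul_le_mul_of_nonneg_left (hyz _) (inv_nonneg.2 (hn0 _).le)
    have := hDlim.sub h0
    rw [sub_zero] at this
    refine this.congr fun j => ?_
    simp only [Function.comp_apply, ← smul_sub]
    congr 1
    abel
  -- Once `n (ψ j) ≥ s`, the point `y₀ + (s / n (ψ j)) • (x - y₀)` lies on the segment from `y₀` to
  -- `x`; closedness gives the limit.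
  have ray : ∀ {S : Set E} {x : ι → E}, IsClosed S → Convex ℝ S → y₀ ∈ S → (∀ k, x k ∈ S) →
      Tendsto (fun j => (n (ψ j))⁻¹ • (x (i (ψ j)) - y₀)) atTop (𝓝 D) → ∀ s : ℝ, 0 ≤ s →
      y₀ + s • D ∈ S := by
    intro S x hSc hS h0 hx hlim s hs
    refine hSc.mem_of_tendsto ((hlim.const_smul s).const_add y₀) ?_
    filter_upwards [(hninf.comp hψ.tendsto_atTop).eventually_ge_atTop s] with j hj
    rw [smul_smul]
    refine hS.add_smul_sub_mem h0 (hx _) ⟨mul_nonneg hs (inv_nonneg.2 (hn0 _).le), ?_⟩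
    rw [← div_eq_mul_inv]
    exact (div_le_one (hn0 _)).2 hj
  have hCD : ⟪C, D⟫ ≤ 0 := by
    have l1 : Tendsto (fun j => ⟪C, (n (ψ j))⁻¹ • (y (i (ψ j)) - y₀)⟫) atTop (𝓝 ⟪C, D⟫) :=
      tendsto_const_nhds.inner hDlim
    have l2 : Tendsto (fun j => (n (ψ j))⁻¹ * (b - ⟪C, y₀⟫)) atTop (𝓝 0) := by
      simpa using hninv'.mul_const (b - ⟪C, y₀⟫)
    refine le_of_tendsto_of_tendsto' l1 l2 fun j => ?_
    rw [inner_smul_right, inner_sub_right]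
    exact mul_le_mul_of_nonneg_left (by linarith [hC (i (ψ j))]) (inv_nonneg.2 (hn0 _).le)
  have hL0 : 0 ≤ L := (norm_nonneg _).trans (hL y₀ hyM hyP le_rfl)
  -- Large enough that `y₀ + s • D` has norm at least `L + 1`, although its cost does not exceed
  -- that of `y₀`.
  set s := L + ‖y₀‖ + 1 with hsdef
  have hs : 0 ≤ s := by positivity
  have := hL (y₀ + s • D) (ray hMc hM hyM hy hDlim s hs) (ray hPc hP hyP hz hzlim s hs) (by
    rw [inner_add_right, inner_smul_right]
    nlinarith)
  have h2 : ‖s • D‖ ≤ ‖y₀ + s • D‖ + ‖y₀‖ := by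
    have := norm_sub_le (y₀ + s • D) y₀
    rwa [add_sub_cancel_left] at this
  rw [norm_smul, hD, Real.norm_of_nonneg hs] at h2
  linarith

end ProximalPoint

/-! ### Projections onto cones of matrices and the multiplier update. -/

noncomputable section

namespace ProximalPoint

open scoped RealInnerProductSpace

variable {E : Type*} [NormedAddCommGroup E] [InnerProductSpace ℝ E] {K : Set E}

theorem IsConeProj.unique {x w w' : E} (h : IsConeProj K x w) (h' : IsConeProj K x w') :
    w = w' := by
  have e : ⟪w - w', w - w'⟫ = ⟪x - w', w⟫ - ⟪x - w', w'⟫ - ⟪x - w, w⟫ + ⟪x - w, w'⟫ := by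
    simp only [inner_sub_left, inner_sub_right]
    ring
  have h0 : ⟪w - w', w - w'⟫ ≤ 0 := by
    rw [e, h.inner_self_eq_zero, h'.inner_self_eq_zero]
    linarith [h'.inner_le_zero w h.mem, h.inner_le_zero w' h'.mem]
  exact sub_eq_zero.1 (_root_.inner_self_eq_zero (𝕜 := ℝ).1 (h0.antisymm real_inner_self_nonneg))

theorem IsConeProj.smul {x w : E} (h : IsConeProj K x w) {s : ℝ} (hs : 0 ≤ s)
    (hK : s • w ∈ K) : IsConeProj K (s • x) (s • w) where
  mem := hK
  inner_self_eq_zero := by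
    rw [← smul_sub, inner_smul_left, inner_smul_right, h.inner_self_eq_zero]
    simp
  inner_le_zero u hu := by
    rw [← smul_sub, inner_smul_left]
    exact mul_nonpos_of_nonneg_of_nonpos hs (h.inner_le_zero u hu)

/-- Orthogonality gives `‖w‖² = ⟪W, w⟫ - s * ⟪w, y⟫ ≤ ‖W‖ * ‖w‖`. With `y ∈ P` and `w` in the dual
cone, this controls the penalty at a feasible point. -/
theorem IsConeProj.norm_le {W y w : E} {s : ℝ} (hs : 0 ≤ s) (h : IsConeProj K (W - s • y) w)
    (hy : 0 ≤ ⟪w, y⟫) : ‖w‖ ≤ ‖W‖ := by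
  have h0 := h.inner_self_eq_zero
  rw [inner_sub_left, inner_sub_left, real_inner_self_eq_norm_sq, inner_smul_left,
    RCLike.conj_to_real, real_inner_comm w y] at h0
  have h1 := real_inner_le_norm W w
  have h2 := mul_nonneg hs hy
  by_contra! hlt
  nlinarith [norm_nonneg W]

end ProximalPoint

namespace ALM

open ProximalPoint

variable {m n : ℕ}

/-- The Frobenius isometry of `Mat n` onto a Euclidean space. -/
def vec : Mat n ≃L[ℝ] EuclideanSpace ℝ (Fin (n + 1) × Fin (n + 1)) :=
  LinearEquiv.toContinuousLinearEquiv
  { toFun := fun X => WithLp.toLp 2 fun p => X p.1 p.2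
    invFun := fun v => Matrix.of fun i j => v (i, j)
    map_add' := fun _ _ => rfl
    map_smul' := fun _ _ => rfl
    left_inv := fun _ => rfl
    right_inv := fun _ => rfl }

theorem vec_apply (X : Mat n) (p : Fin (n + 1) × Fin (n + 1)) : vec X p = X p.1 p.2 := rfl

theorem inner_vec (X Y : Mat n) : Inner.inner ℝ (vec X) (vec Y) = inner X Y := by
  simp only [inner, PiLp.inner_apply, Matrix.trace, Matrix.mul_apply, Matrix.diag,
    Fintype.sum_prod_type, vec_apply, Matrix.transpose_apply]
  simp [mul_comm]

theorem norm_vec (X : Mat n) : ‖vec X‖ = norm X := by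
  rw [norm, ← inner_vec, real_inner_self_eq_norm_sq, Real.sqrt_sq (norm_nonneg _)]

theorem inner_add_left (X Y Z : Mat n) : inner (X + Y) Z = inner X Z + inner Y Z := by
  simp only [← inner_vec, map_add, _root_.inner_add_left]

theorem inner_sub_left (X Y Z : Mat n) : inner (X - Y) Z = inner X Z - inner Y Z := by
  simp only [← inner_vec, map_sub, _root_.inner_sub_left]

theorem inner_neg_left (X Z : Mat n) : inner (-X) Z = -inner X Z := by
  simp only [← inner_vec, map_neg, _root_.inner_neg_left]

theorem inner_smul_left (s : ℝ) (X Z : Mat n) : inner (s • X) Z = s * inner X Z := by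
  simp only [← inner_vec, map_smul, real_inner_smul_left]

theorem inner_comm (X Y : Mat n) : inner X Y = inner Y X := by
  simp only [← inner_vec, real_inner_comm]

theorem inner_add_right (X Y Z : Mat n) : inner X (Y + Z) = inner X Y + inner X Z := by
  simp only [inner_comm X, inner_add_left]

theorem inner_smul_right (s : ℝ) (X Z : Mat n) : inner X (s • Z) = s * inner X Z := by
  simp only [inner_comm X, inner_smul_left]

theorem norm_smul_of_nonneg {s : ℝ} (hs : 0 ≤ s) (X : Mat n) : norm (s • X) = s * norm X := by
  rw [← norm_vec, ← norm_vec, map_smul, norm_smul, Real.norm_of_nonneg hs]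

@[fun_prop]
theorem continuous_inner_right (X : Mat n) : Continuous (inner X) := by
  have : inner X = fun Y => Inner.inner ℝ (vec X) (vec Y) := by
    ext Y
    rw [inner_vec]
  rw [this]
  fun_prop

@[fun_prop]
theorem continuous_norm : Continuous (norm : Mat n → ℝ) := by
  have : (norm : Mat n → ℝ) = fun Y => ‖vec Y‖ := by
    ext Y
    rw [norm_vec]
  rw [this]
  fun_prop

/-- A closed convex cone of symmetric matrices. -/
structure IsClosedConvexCone (S : Set (Mat n)) : Prop where
  isClosed : IsClosed S
  isSymm : ∀ X ∈ S, X.IsSymm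
  zero_mem : 0 ∈ S
  add_mem : ∀ X ∈ S, ∀ Y ∈ S, X + Y ∈ S
  smul_mem : ∀ s : ℝ, 0 ≤ s → ∀ X ∈ S, s • X ∈ S

theorem IsClosedConvexCone.convex {S : Set (Mat n)} (hS : IsClosedConvexCone S) : Convex ℝ S :=
  fun _ hX _ hY _ _ ha hb _ => hS.add_mem _ (hS.smul_mem _ ha _ hX) _ (hS.smul_mem _ hb _ hY)

theorem isClosed_isSymm : IsClosed {X : Mat n | X.IsSymm} :=
  isClosed_eq (continuous_id.matrix_transpose) continuous_id

theorem IsPolyhedralCone.isClosedConvexCone {P : Set (Mat n)} (hP : IsPolyhedralCone P) :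
    IsClosedConvexCone P := by
  obtain ⟨N, H, -, rfl⟩ := hP
  refine ⟨?_, fun X hX => hX.1, ?_, ?_, ?_⟩
  · simp only [Set.ofPred_and, Set.ofPred_forall]
    exact isClosed_isSymm.inter
      (isClosed_iInter fun i => isClosed_le continuous_const (continuous_inner_right _))
  · exact ⟨Matrix.isSymm_zero, fun i => by simp [inner]⟩
  · rintro X ⟨hX, hX'⟩ Y ⟨hY, hY'⟩
    exact ⟨hX.add hY, fun i => by rw [inner_add_right]; exact add_nonneg (hX' i) (hY' i)⟩
  · rintro s hs X ⟨hX, hX'⟩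
    exact ⟨hX.smul s, fun i => by rw [inner_smul_right]; exact mul_nonneg hs (hX' i)⟩

theorem isClosedConvexCone_dualCone (P : Set (Mat n)) : IsClosedConvexCone (dualCone P) := by
  refine ⟨?_, fun X hX => hX.1, ?_, ?_, ?_⟩
  · simp only [dualCone, Set.ofPred_and, Set.ofPred_forall]
    refine isClosed_isSymm.inter (isClosed_biInter fun X _ => ?_)
    simp only [inner_comm _ X]
    exact isClosed_le continuous_const (continuous_inner_right _)
  · exact ⟨Matrix.isSymm_zero, fun i _ => by simp [inner]⟩
  · rintro X ⟨hX, hX'⟩ Y ⟨hY, hY'⟩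
    exact ⟨hX.add hY, fun Z hZ => by
      rw [inner_add_left]; exact add_nonneg (hX' Z hZ) (hY' Z hZ)⟩
  · rintro s hs X ⟨hX, hX'⟩
    exact ⟨hX.smul s, fun Z hZ => by rw [inner_smul_left]; exact mul_nonneg hs (hX' Z hZ)⟩

theorem isClosed_vec_image {S : Set (Mat n)} (hS : IsClosed S) : IsClosed (vec '' S) :=
  vec.toHomeomorph.isClosed_image.2 hS

theorem convex_vec_image {S : Set (Mat n)} (hS : Convex ℝ S) : Convex ℝ (vec '' S) :=
  hS.is_linear_image vec.toLinearMap.isLinear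

/-- The metric projection onto a closed convex cone is characterized by the usual variational
conditions. -/
theorem IsClosedConvexCone.isConeProj_proj {S : Set (Mat n)} (hS : IsClosedConvexCone S)
    (X : Mat n) : IsConeProj (vec '' S) (vec X) (vec (proj S X)) := by
  have hcl := isClosed_vec_image hS.isClosed
  have hcv := convex_vec_image hS.convex
  have hbdd : BddBelow (Set.range fun w : vec '' S => ‖vec X - w‖) :=
    ⟨0, by rintro _ ⟨w, rfl⟩; exact norm_nonneg _⟩
  have hex : ∃ Y ∈ S, ∀ Y' ∈ S, norm (X - Y) ≤ norm (X - Y') := by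
    obtain ⟨_, ⟨Y, hY, rfl⟩, hmin⟩ := exists_norm_eq_iInf_of_complete_convex
      ⟨_, Set.mem_image_of_mem vec hS.zero_mem⟩ hcl.isComplete hcv (vec X)
    refine ⟨Y, hY, fun Y' hY' => ?_⟩
    rw [← norm_vec, ← norm_vec, map_sub, map_sub, hmin]
    exact ciInf_le hbdd ⟨_, Set.mem_image_of_mem vec hY'⟩
  have hspec : proj S X ∈ S ∧ ∀ Y' ∈ S, norm (X - proj S X) ≤ norm (X - Y') := by
    rw [proj, dif_pos hex]
    exact hex.choose_spec
  have hmem := Set.mem_image_of_mem vec hspec.1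
  have : Nonempty (vec '' S) := ⟨⟨_, hmem⟩⟩
  have hle := (norm_eq_iInf_iff_real_inner_le_zero hcv hmem (u := vec X)).1 (le_antisymm
    (le_ciInf (by
      rintro ⟨_, Y', hY', rfl⟩
      rw [← map_sub, ← map_sub, norm_vec, norm_vec]
      exact hspec.2 Y' hY')) (ciInf_le hbdd ⟨_, hmem⟩))
  refine ⟨hmem, le_antisymm ?_ ?_, ?_⟩
  -- Testing the projection inequality at twice the projection, at `0` and at `U` plus the
  -- projection turns it into the cone conditions.
  · have := hle (vec (proj S X + proj S X))
      (Set.mem_image_of_mem vec (hS.add_mem _ hspec.1 _ hspec.1))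
    rwa [map_add, add_sub_cancel_right] at this
  · have := hle (vec 0) (Set.mem_image_of_mem vec hS.zero_mem)
    rw [map_zero, zero_sub, _root_.inner_neg_right] at this
    linarith
  · rintro _ ⟨U, hU, rfl⟩
    have := hle (vec (U + proj S X)) (Set.mem_image_of_mem vec (hS.add_mem _ hU _ hspec.1))
    rwa [map_add, add_sub_cancel_right] at this

/-- Moreau's decomposition with respect to a closed convex cone and its dual. -/
theorem IsClosedConvexCone.proj_dualCone {P : Set (Mat n)} (hP : IsClosedConvexCone P)
    {X : Mat n} (hX : X.IsSymm) : proj (dualCone P) X = X + proj P (-X) := by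
  have h := hP.isConeProj_proj (-X)
  have hZ : proj P (-X) ∈ P := vec.injective.mem_set_image.1 h.mem
  have e : vec X - vec (X + proj P (-X)) = -vec (proj P (-X)) := by rw [map_add]; abel
  have e' : vec (X + proj P (-X)) = -(vec (-X) - vec (proj P (-X))) := by
    rw [map_add, map_neg]; abel
  refine vec.injective (((isClosedConvexCone_dualCone P).isConeProj_proj X).unique
    ⟨Set.mem_image_of_mem vec ⟨hX.add (hP.isSymm _ hZ), fun Q hQ => ?_⟩, ?_, ?_⟩)
  · rw [← inner_vec, e', _root_.inner_neg_left]
    linarith [h.inner_le_zero _ (Set.mem_image_of_mem vec hQ)]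
  · rw [e, e', inner_neg_neg, real_inner_comm, h.inner_self_eq_zero]
  · rintro _ ⟨U, hU, rfl⟩
    rw [e, _root_.inner_neg_left, inner_vec, inner_comm]
    linarith [hU.2 _ hZ]

/-- The multiplier update `σ Π_{P*}(σ⁻¹ W - Y)`. -/
def multiplierStep (P : Set (Mat n)) (σ : ℝ) (W Y : Mat n) : Mat n :=
  σ • proj (dualCone P) (σ⁻¹ • W - Y)

variable {P : Set (Mat n)} {σ : ℝ} {C W Y : Mat n}

theorem isConeProj_multiplierStep (hσ : 0 < σ) :
    IsConeProj (vec '' dualCone P) (vec W - σ • vec Y) (vec (multiplierStep P σ W Y)) := by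
  have hK := isClosedConvexCone_dualCone P
  have h := hK.isConeProj_proj (σ⁻¹ • W - Y)
  have e : vec W - σ • vec Y = σ • vec (σ⁻¹ • W - Y) := by
    rw [map_sub, map_smul, smul_sub, smul_inv_smul₀ hσ.ne']
  rw [e, multiplierStep, map_smul]
  refine h.smul hσ.le ?_
  rw [← map_smul]
  exact Set.mem_image_of_mem vec
    (hK.smul_mem σ hσ.le _ (vec.injective.mem_set_image.1 h.mem))

theorem multiplierStep_mem (hσ : 0 < σ) : multiplierStep P σ W Y ∈ dualCone P :=
  vec.injective.mem_set_image.1 (isConeProj_multiplierStep hσ).mem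

theorem phi_eq (hσ : 0 < σ) :
    phi C P σ W Y = inner C Y + norm (multiplierStep P σ W Y) ^ 2 / (2 * σ) := by
  rw [phi, multiplierStep, norm_smul_of_nonneg hσ.le]
  field_simp

theorem norm_multiplierStep_le (hσ : 0 < σ) (hY : Y ∈ P) :
    norm (multiplierStep P σ W Y) ≤ norm W := by
  rw [← norm_vec, ← norm_vec]
  refine (isConeProj_multiplierStep hσ).norm_le hσ.le ?_
  rw [inner_vec]
  exact (multiplierStep_mem hσ).2 Y hY

/-- Moreau's decomposition identifies the update through `Z` with a scaled projection onto the dual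
cone. -/
theorem multiplierStep_eq (hP : IsClosedConvexCone P) (hσ : 0 < σ) (hW : W.IsSymm)
    (hY : Y.IsSymm) :
    multiplierStep P σ W Y = W - σ • (Y - proj P (Y - σ⁻¹ • W)) := by
  rw [multiplierStep, hP.proj_dualCone ((hW.smul _).sub hY), neg_sub, smul_add, smul_sub,
    smul_inv_smul₀ hσ.ne', smul_sub]
  abel

/-- Weak duality for the subproblem: a `U` with finite dual value bounds `φ` below on `M`. -/
theorem phi_ge_of_mem_dualCone (hσ : 0 < σ) {U : Mat n} (hU : U ∈ dualCone P) :
    inner (C - U) Y - (norm (U - W) ^ 2 - norm W ^ 2) / (2 * σ) ≤ phi C P σ W Y := by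
  have h := proxLagrangian_add_le (C := vec C) hσ (isConeProj_multiplierStep (P := P) (W := W)
    (Y := Y) hσ) (Set.mem_image_of_mem vec hU)
  rw [proxLagrangian, ← map_sub, ← map_sub, ← map_sub, inner_vec, inner_vec] at h
  simp only [norm_vec] at h
  rw [phi_eq hσ]
  have : 0 ≤ norm (U - multiplierStep P σ W Y) ^ 2 / (2 * σ) := by positivity
  linarith

/-! ### The dual problem in terms of the multiplier alone. -/

section Dual

variable {A : Matrix (Fin m) (Fin n) ℝ} {b : Fin m → ℝ} {B : Finset (Fin n)}

theorem supportFn_le_iff {S₁ S₂ : Mat n} {c : ℝ} :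
    supportFn A b B P S₁ S₂ ≤ (c : EReal) ↔
      ∀ Y ∈ feasM A b B, ∀ Z ∈ P, inner S₁ Y + inner S₂ Z ≤ c := by
  simp only [supportFn, iSup_le_iff, EReal.coe_le_coe_iff]

theorem supportFn_le_of_mem_dualCone {U : Mat n} (hU : U ∈ dualCone P) {γ : ℝ}
    (h : ∀ Y ∈ feasM A b B, γ ≤ inner (C - U) Y) :
    supportFn A b B P (U - C) (-U) ≤ ((-γ : ℝ) : EReal) := by
  rw [supportFn_le_iff]
  intro Y hY Z hZ
  have h1 := h Y hY
  have h2 := hU.2 Z hZ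
  rw [inner_sub_left] at h1 ⊢
  rw [inner_neg_left]
  linarith

theorem mem_dualCone_of_supportFn_le (hP : IsClosedConvexCone P) (hM : (feasM A b B).Nonempty)
    {U : Mat n} (hU : U.IsSymm) {c : ℝ} (h : supportFn A b B P (U - C) (-U) ≤ (c : EReal)) :
    U ∈ dualCone P ∧ ∀ Y ∈ feasM A b B, -c ≤ inner (C - U) Y := by
  rw [supportFn_le_iff] at h
  refine ⟨⟨hU, fun Z hZ => ?_⟩, fun Y hY => ?_⟩
  · obtain ⟨Y, hY⟩ := hM
    by_contra! hneg
    -- If `⟨U, Z⟩ < 0`, scaling `Z` by this factor makes the support function exceed `c`.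
    set s := (|c - inner (U - C) Y| + 1) / (-inner U Z) with hs
    have hs0 : 0 ≤ s := div_nonneg (by positivity) (by linarith)
    have h1 := h Y hY _ (hP.smul_mem s hs0 Z hZ)
    have h2 : s * -inner U Z = |c - inner (U - C) Y| + 1 :=
      div_mul_cancel₀ _ (by linarith)
    rw [inner_smul_right, inner_neg_left, h2] at h1
    linarith [le_abs_self (c - inner (U - C) Y)]
  · have h1 := h Y hY 0 hP.zero_mem
    have h2 : inner (-U) (0 : Mat n) = 0 := by simp [inner]
    rw [inner_sub_left] at h1 ⊢
    linarith

/-- The dual problem as the maximization of `U ↦ inf_{Y ∈ M} ⟨C - U, Y⟩` over the dual cone. -/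
theorem exists_dual_value (hC : C.IsSymm) (hP : IsClosedConvexCone P)
    (hM : (feasM A b B).Nonempty) (hD : (dualSolutions C A b B P).Nonempty) :
    ∃ γ : ℝ, (∃ U ∈ dualCone P, ∀ Y ∈ feasM A b B, γ ≤ inner (C - U) Y) ∧
      (∀ U ∈ dualCone P, ∀ c : ℝ, (∀ Y ∈ feasM A b B, c ≤ inner (C - U) Y) → c ≤ γ) ∧
      ∀ U ∈ dualCone P, (∀ Y ∈ feasM A b B, γ ≤ inner (C - U) Y) →
        (U, U - C, -U) ∈ dualSolutions C A b B P := by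
  obtain ⟨⟨U, S₁, S₂⟩, ⟨hU, -, -, h1, h2, hfin⟩, hopt⟩ := hD
  simp only at hU h1 h2 hfin hopt
  obtain rfl : S₁ = U - C := by
    rw [eq_sub_iff_add_eq, add_comm]
    exact sub_eq_zero.1 h1
  obtain rfl : S₂ = -U := eq_neg_of_add_eq_zero_left h2
  -- Nonemptiness of `M` and `0 ∈ P` exclude `⊥`, so the optimal dual value is a real number.
  have hbot : supportFn A b B P (U - C) (-U) ≠ ⊥ := by
    obtain ⟨Y, hY⟩ := hM
    refine ne_bot_of_le_ne_bot (EReal.coe_ne_bot (inner (U - C) Y + inner (-U) 0)) ?_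
    exact le_iSup₂_of_le Y hY (le_iSup₂_of_le 0 hP.zero_mem le_rfl)
  obtain ⟨c, hc⟩ : ∃ c : ℝ, supportFn A b B P (U - C) (-U) = c :=
    ⟨_, (EReal.coe_toReal hfin hbot).symm⟩
  have hfeas : ∀ V ∈ dualCone P, ∀ γ : ℝ, (∀ Y ∈ feasM A b B, γ ≤ inner (C - V) Y) →
      (V, V - C, -V) ∈ dualFeasible C A b B P := fun V hV γ h =>
    ⟨hV.1, hV.1.sub hC, hV.1.neg, by simp, by simp,
      ((supportFn_le_of_mem_dualCone hV h).trans_lt (EReal.coe_lt_top _)).ne⟩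
  obtain ⟨hUK, hUc⟩ := mem_dualCone_of_supportFn_le hP hM hU hc.le
  refine ⟨-c, ⟨U, hUK, hUc⟩, fun V hV d hd => ?_, fun V hV h => ⟨hfeas V hV _ h, ?_⟩⟩
  · have h3 := hopt _ (hfeas V hV d hd)
    rw [EReal.neg_le_neg_iff, hc] at h3
    have := h3.trans (supportFn_le_of_mem_dualCone hV hd)
    rw [EReal.coe_le_coe_iff] at this
    linarith
  · intro t ht
    refine (hopt t ht).trans ?_
    rw [EReal.neg_le_neg_iff, hc]
    simpa using supportFn_le_of_mem_dualCone hV h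

end Dual

end ALM
end

/-! ### The set `M` and its low-rank factorization. -/

noncomputable section

namespace ALM

variable {m n : ℕ}

theorem posSemidef_iff (Y : Mat n) :
    Y.PosSemidef ↔ Y.IsSymm ∧ ∀ x : Fin (n + 1) → ℝ, 0 ≤ dotProduct x (Y.mulVec x) := by
  rw [Matrix.posSemidef_iff_dotProduct_mulVec]
  simp [Matrix.IsHermitian, Matrix.IsSymm, Matrix.conjTranspose_eq_transpose_of_trivial]

variable {A : Matrix (Fin m) (Fin n) ℝ} {b : Fin m → ℝ} {B : Finset (Fin n)}

theorem isClosed_feasM : IsClosed (feasM A b B) := by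
  simp only [feasM, affineSet, posSemidef_iff, Set.ofPred_and, Set.ofPred_forall]
  have hv : Continuous (blockVec : Mat n → _) := by unfold blockVec; fun_prop
  have hm : Continuous (blockMat : Mat n → _) := by
    unfold blockMat
    exact continuous_matrix fun i j => continuous_id.matrix_elem i.succ j.succ
  refine ((isClosed_isSymm.inter ((isClosed_eq (by fun_prop) continuous_const).inter
    ((isClosed_eq (by fun_prop) continuous_const).inter ((isClosed_eq (by fun_prop) ?_).inter
    (isClosed_iInter fun i => isClosed_iInter fun _ => isClosed_eq (by fun_prop) ?_)))))).inter
    (isClosed_isSymm.inter (isClosed_iInter fun x => isClosed_le continuous_const ?_))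
  · exact continuous_matrix fun i j => by
      simp only [Matrix.vecMulVec_apply]
      fun_prop
  · exact hm.matrix_elem i i
  · exact continuous_const.dotProduct (continuous_id.matrix_mulVec continuous_const)

theorem convex_feasM : Convex ℝ (feasM A b B) := by
  rintro X ⟨⟨hX1, hX2, hX3, hX4, hX5⟩, hXp⟩ Y ⟨⟨hY1, hY2, hY3, hY4, hY5⟩, hYp⟩ s t hs ht hst
  have ev : blockVec (s • X + t • Y) = s • blockVec X + t • blockVec Y := rfl
  have em : blockMat (s • X + t • Y) = s • blockMat X + t • blockMat Y := rfl
  refine ⟨⟨(hX1.smul s).add (hY1.smul t), ?_, ?_, ?_, fun i hi => ?_⟩,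
    (hXp.smul hs).add (hYp.smul ht)⟩
  · simp [hX2, hY2, hst]
  · rw [ev, Matrix.mulVec_add, Matrix.mulVec_smul, Matrix.mulVec_smul, hX3, hY3, ← add_smul, hst,
      one_smul]
  · rw [ev, em, Matrix.mul_add, Matrix.mul_smul, Matrix.mul_smul, hX4, hY4, Matrix.vecMulVec_add,
      Matrix.vecMulVec_smul, Matrix.vecMulVec_smul]
  · rw [ev, em]
    simp [hX5 i hi, hY5 i hi]

section Factor

variable {r : ℕ}

theorem e₁_dotProduct_self (hr : 1 ≤ r) : dotProduct (e₁ r) (e₁ r) = 1 := by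
  obtain ⟨k, rfl⟩ : ∃ k, r = k + 1 := ⟨r - 1, by omega⟩
  simp [dotProduct, e₁]

theorem hat_mul_transpose_apply (Q : Matrix (Fin n) (Fin r) ℝ) (i j : Fin (n + 1)) :
    (hat Q * (hat Q).transpose) i j = dotProduct (hat Q i) (hat Q j) := by
  simp [Matrix.mul_apply, dotProduct]

theorem hat_zero (Q : Matrix (Fin n) (Fin r) ℝ) : hat Q 0 = e₁ r := rfl

theorem hat_succ (Q : Matrix (Fin n) (Fin r) ℝ) (i : Fin n) : hat Q i.succ = Q i := rfl

theorem blockVec_hat (Q : Matrix (Fin n) (Fin r) ℝ) :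
    blockVec (hat Q * (hat Q).transpose) = Q.mulVec (e₁ r) := by
  ext i
  rw [blockVec, hat_mul_transpose_apply, hat_zero, hat_succ]
  rfl

theorem blockMat_hat (Q : Matrix (Fin n) (Fin r) ℝ) :
    blockMat (hat Q * (hat Q).transpose) = Q * Q.transpose := by
  ext i j
  rw [blockMat, Matrix.of_apply, hat_mul_transpose_apply, hat_succ, hat_succ, Matrix.mul_apply]
  rfl

theorem hat_mem_feasM (hr : 1 ≤ r) {Q : Matrix (Fin n) (Fin r) ℝ} (hQ : Q ∈ feasR A b B r) :
    hat Q * (hat Q).transpose ∈ feasM A b B := by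
  have hp : (hat Q * (hat Q).transpose).PosSemidef := by
    rw [← Matrix.conjTranspose_eq_transpose_of_trivial]
    exact Matrix.posSemidef_self_mul_conjTranspose _
  refine ⟨⟨((posSemidef_iff _).1 hp).1, ?_, ?_, ?_, fun i hi => ?_⟩, hp⟩
  · rw [hat_mul_transpose_apply, hat_zero, e₁_dotProduct_self hr]
  · rw [blockVec_hat, Matrix.mulVec_mulVec, hQ.1, Matrix.vecMulVec_mulVec, e₁_dotProduct_self hr]
    simp
  · rw [blockVec_hat, blockMat_hat, ← Matrix.mul_assoc, hQ.1, Matrix.vecMulVec_mul,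
      Matrix.vecMul_transpose]
  · rw [blockVec_hat, blockMat_hat, hQ.2 i hi]

/-- A positive semidefinite matrix of rank at most `r` is a Gram matrix of vectors in `ℝʳ`. -/
theorem exists_gram_of_posSemidef {ι : Type*} [Fintype ι] [DecidableEq ι] {Y : Matrix ι ι ℝ}
    (hY : Y.PosSemidef) (hr : Y.rank ≤ r) :
    ∃ v : ι → EuclideanSpace ℝ (Fin r), ∀ i j, Y i j = Inner.inner ℝ (v i) (v j) := by
  have hH := hY.isHermitian
  rw [hH.rank_eq_card_non_zero_eigs] at hr
  -- The rank counts the nonzero eigenvalues, so they can be assigned distinct coordinates of `ℝʳ`;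
  -- the others contribute nothing to the spectral sum.
  obtain ⟨f⟩ : Nonempty ({i // hH.eigenvalues i ≠ 0} ↪ Fin r) :=
    Function.Embedding.nonempty_of_card_le (by simpa using hr)
  let g : {i // hH.eigenvalues i ≠ 0} → EuclideanSpace ℝ (Fin r) := fun a =>
    EuclideanSpace.single (f a) 1
  have hg : ∀ a c, Inner.inner ℝ (g a) (g c) = if a = c then (1 : ℝ) else 0 := by
    intro a c
    simp only [g, EuclideanSpace.inner_single_left, map_one, one_mul, PiLp.single_apply,
      f.injective.eq_iff]
  refine ⟨fun i => ∑ a : {i // hH.eigenvalues i ≠ 0}, (√(hH.eigenvalues a) * hH.eigenvectorUnitary.1 i a) •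
    g a, fun i j => ?_⟩
  simp only [sum_inner, inner_sum, real_inner_smul_left, real_inner_smul_right, hg]
  simp only [mul_ite, mul_one, mul_zero, Finset.sum_ite_eq', Finset.mem_univ,
    if_true]
  have hs := congrFun (congrFun hH.spectral_theorem i) j
  rw [Unitary.conjStarAlgAut_apply, Matrix.mul_apply] at hs
  simp only [Matrix.mul_diagonal, Function.comp_apply, RCLike.ofReal_real_eq_id, id_eq,
    Matrix.star_apply, star_trivial] at hs
  rw [hs, ← Finset.sum_filter_of_ne (p := fun k => hH.eigenvalues k ≠ 0),
    ← Finset.sum_subtype_eq_sum_filter]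
  · simp only [Finset.subtype_univ]
    refine Finset.sum_congr rfl fun a _ => ?_
    have := Real.mul_self_sqrt (hY.eigenvalues_nonneg a)
    linear_combination (-(hH.eigenvectorUnitary.1 i a) * hH.eigenvectorUnitary.1 j a) * this
  · intro k _ hk h0
    rw [h0] at hk
    simp at hk

/-- Every matrix in `M` of rank at most `r` is of the form `R̂ R̂ᵀ` with `R ∈ M_r`. -/
theorem exists_hat_eq (hr : 1 ≤ r) {Y : Mat n} (hY : Y ∈ feasM A b B) (hrank : Y.rank ≤ r) :
    ∃ Q ∈ feasR A b B r, hat Q * (hat Q).transpose = Y := by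
  obtain ⟨⟨hY1, hY2, hY3, hY4, hY5⟩, hp⟩ := hY
  obtain ⟨v, hv⟩ := exists_gram_of_posSemidef hp hrank
  set u : EuclideanSpace ℝ (Fin r) := WithLp.toLp 2 (e₁ r) with hu
  have hnorm : ‖v 0‖ = ‖u‖ := by
    have h1 : ‖v 0‖ ^ 2 = 1 := by rw [← real_inner_self_eq_norm_sq, ← hv, hY2]
    have h2 : ‖u‖ ^ 2 = 1 := by
      rw [← real_inner_self_eq_norm_sq, EuclideanSpace.inner_eq_star_dotProduct]
      simpa using e₁_dotProduct_self hr
    exact (sq_eq_sq₀ (norm_nonneg _) (norm_nonneg _)).1 (h1.trans h2.symm)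
  -- Since `Y 0 0 = 1`, both `v 0` and `e₁` are unit vectors; this reflection exchanges them and
  -- preserves the Gram matrix.
  set ρ := (Submodule.span ℝ {v 0 - u})ᗮ.reflection
  have hρ : ρ (v 0) = u := Submodule.reflection_sub hnorm
  set Q : Matrix (Fin n) (Fin r) ℝ := Matrix.of fun i => (ρ (v i.succ)).ofLp
  have hrow : ∀ i, hat Q i = (ρ (v i)).ofLp := by
    refine Fin.cases ?_ fun i => rfl
    rw [hρ]
    rfl
  have hQY : hat Q * (hat Q).transpose = Y := by
    ext i j
    rw [hat_mul_transpose_apply, hrow, hrow, hv, ← ρ.inner_map_map,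
      EuclideanSpace.inner_eq_star_dotProduct, dotProduct_comm]
    simp
  have hx : blockVec Y = Q.mulVec (e₁ r) := by rw [← hQY, blockVec_hat]
  have hX : blockMat Y = Q * Q.transpose := by rw [← hQY, blockMat_hat]
  rw [hx] at hY3
  rw [hx, hX] at hY4
  refine ⟨Q, ⟨?_, fun i hi => ?_⟩, hQY⟩
  -- With `D = A Q - b e₁ᵀ`, all four products in `D Dᵀ` equal `b bᵀ` and cancel, whence `D = 0`.
  · rw [← sub_eq_zero, ← Matrix.self_mul_conjTranspose_eq_zero,
      Matrix.conjTranspose_eq_transpose_of_trivial]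
    have e1 : A * Q * (A * Q).transpose = Matrix.vecMulVec b b := by
      rw [Matrix.transpose_mul, Matrix.mul_assoc, ← Matrix.mul_assoc Q, ← Matrix.mul_assoc, hY4,
        Matrix.vecMulVec_mul, Matrix.vecMul_transpose, hY3]
    have e2 : A * Q * (Matrix.vecMulVec b (e₁ r)).transpose = Matrix.vecMulVec b b := by
      rw [Matrix.transpose_vecMulVec, Matrix.mul_vecMulVec, ← Matrix.mulVec_mulVec, hY3]
    have e3 : Matrix.vecMulVec b (e₁ r) * (A * Q).transpose = Matrix.vecMulVec b b := by
      rw [Matrix.vecMulVec_mul, Matrix.vecMul_transpose, ← Matrix.mulVec_mulVec, hY3]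
    have e4 : Matrix.vecMulVec b (e₁ r) * (Matrix.vecMulVec b (e₁ r)).transpose =
        Matrix.vecMulVec b b := by
      rw [Matrix.transpose_vecMulVec, Matrix.vecMulVec_mul_vecMulVec, e₁_dotProduct_self hr]
      simp
    rw [Matrix.transpose_sub, Matrix.sub_mul, Matrix.mul_sub, Matrix.mul_sub, e1, e2, e3, e4]
    simp
  · rw [← hX, ← hx, hY5 i hi]

end Factor

end ALM
end

/-! ### From the factorized subproblems to the iterates. -/

noncomputable section

namespace ALM

open ProximalPoint

variable {m n : ℕ} {A : Matrix (Fin m) (Fin n) ℝ} {b : Fin m → ℝ} {B : Finset (Fin n)}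
  {P : Set (Mat n)} {C : Mat n}

theorem bddBelow_fR_image {σ γ : ℝ} (hσ : 0 < σ) {W U : Mat n} (hU : U ∈ dualCone P)
    (hγ : ∀ Y ∈ feasM A b B, γ ≤ inner (C - U) Y) {r : ℕ} (hr : 1 ≤ r) :
    BddBelow ((fun Q => fR C P σ W Q) '' feasR A b B r) := by
  refine ⟨γ - (norm (U - W) ^ 2 - norm W ^ 2) / (2 * σ), ?_⟩
  rintro _ ⟨Q, hQ, rfl⟩
  have h1 := hγ _ (hat_mem_feasM hr hQ)
  have h2 := phi_ge_of_mem_dualCone (C := C) (W := W) (Y := hat Q * (hat Q).transpose) hσ hU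
  simp only [fR]
  linarith

/-- The infimum of the factorized subproblem bounds the convex subproblem from below. -/
theorem sInf_fR_le_phi {σ : ℝ} {W : Mat n} {r : ℕ} (hr : 1 ≤ r)
    (hbdd : BddBelow ((fun Q => fR C P σ W Q) '' feasR A b B r))
    (hrank : RankAdequate C A b B P σ W r) {Y : Mat n} (hY : Y ∈ feasM A b B) :
    sInf ((fun Q => fR C P σ W Q) '' feasR A b B r) ≤ phi C P σ W Y := by
  refine le_of_forall_pos_le_add fun δ hδ => ?_
  obtain ⟨Y', hY', hr', hle⟩ := hrank Y hY δ hδ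
  obtain ⟨Q, hQ, rfl⟩ := exists_hat_eq hr hY' hr'
  exact (csInf_le hbdd ⟨Q, hQ, rfl⟩).trans hle

/-- The exact proximal point of the dual function, near which every approximate solution of the
subproblem places the new multiplier. -/
theorem exists_exact_multiplier {σ γ : ℝ} (hσ : 0 < σ) {W : Mat n} {r : ℕ} (hr : 1 ≤ r)
    (hbdd : BddBelow ((fun Q => fR C P σ W Q) '' feasR A b B r))
    (hrank : RankAdequate C A b B P σ W r)
    (hmax : ∀ U ∈ dualCone P, ∀ c : ℝ, (∀ Y ∈ feasM A b B, c ≤ inner (C - U) Y) → c ≤ γ)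
    {Q : Matrix (Fin n) (Fin r) ℝ} (hQ : Q ∈ feasR A b B r) {ε : ℝ} (hε : 0 ≤ ε)
    (hgap : subproblemGap C A b B P σ W Q ≤ ε ^ 2 / (2 * σ)) :
    ∃ V ∈ vec '' dualCone P,
      ‖vec (multiplierStep P σ W (hat Q * (hat Q).transpose)) - V‖ ≤ ε ∧
      ∀ U ∈ vec '' dualCone P,
        (∀ y ∈ vec '' feasM A b B, γ ≤ Inner.inner ℝ (vec C - U) y) →
        ‖U - V‖ ^ 2 + ‖V - vec W‖ ^ 2 ≤ ‖U - vec W‖ ^ 2 ∧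
        ∀ y ∈ vec '' feasM A b B,
          γ - (‖U - vec W‖ ^ 2 - ‖U - V‖ ^ 2) / (2 * σ) ≤ Inner.inner ℝ (vec C - V) y := by
  -- This is also the infimum of `φ` over `M`: rank adequacy gives the lower bound, and factorized
  -- points in `M` approach it.
  set μ := sInf ((fun Q => fR C P σ W Q) '' feasR A b B r) with hμ
  have hphi : ∀ Y : Mat n, Inner.inner ℝ (vec C) (vec Y) +
      ‖vec (multiplierStep P σ W Y)‖ ^ 2 / (2 * σ) = phi C P σ W Y := fun Y => by
    rw [inner_vec, norm_vec, phi_eq hσ]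
  obtain ⟨V, hV, hlag, hVμ⟩ := exists_proximal_point (C := vec C) (W := vec W) (σ := σ)
    (M := vec '' feasM A b B) (K := vec '' dualCone P) (μ := μ)
    (w := fun y => vec (multiplierStep P σ W (vec.symm y))) hσ (convex_vec_image convex_feasM)
    (isClosed_vec_image (isClosedConvexCone_dualCone P).isClosed)
    (by
      rintro _ ⟨Y, -, rfl⟩
      rw [vec.symm_apply_apply]
      exact isConeProj_multiplierStep hσ)
    (by
      rintro _ ⟨Y, hY, rfl⟩
      rw [vec.symm_apply_apply, hphi]
      exact sInf_fR_le_phi hr hbdd hrank hY)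
    (fun δ hδ => by
      obtain ⟨_, ⟨Q', hQ', rfl⟩, hlt⟩ :=
        exists_lt_of_csInf_lt (⟨_, Q, hQ, rfl⟩ :
          ((fun Q => fR C P σ W Q) '' feasR A b B r).Nonempty) (lt_add_of_pos_right μ hδ)
      refine ⟨_, ⟨_, hat_mem_feasM hr hQ', rfl⟩, ?_⟩
      rw [vec.symm_apply_apply, hphi]
      exact hlt.le)
  refine ⟨V, hV, ?_, fun U hU hUγ => proximal_point_estimates hσ hV hlag hVμ ?_ hU hUγ⟩
  -- At the computed point, `μ ≤ proxLagrangian ≤ φ - ‖V - w‖² / (2σ)`, where `w` is the new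
  -- multiplier; the allowed gap gives `‖V - w‖ ≤ ε`.
  · have h1 := hlag _ (Set.mem_image_of_mem vec (hat_mem_feasM hr hQ))
    have h2 := proxLagrangian_add_le (C := vec C) hσ (isConeProj_multiplierStep (P := P) (W := W)
      (Y := hat Q * (hat Q).transpose) hσ) hV
    rw [hphi] at h2
    have h3 : phi C P σ W (hat Q * (hat Q).transpose) - μ ≤ ε ^ 2 / (2 * σ) := hgap
    have h4 : ‖V - vec (multiplierStep P σ W (hat Q * (hat Q).transpose))‖ ^ 2 / (2 * σ) ≤
        ε ^ 2 / (2 * σ) := by linarith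
    rw [div_le_div_iff_of_pos_right (by positivity)] at h4
    rw [norm_sub_rev]
    exact (sq_le_sq₀ (norm_nonneg _) hε).1 h4
  · rintro _ ⟨U, hU, rfl⟩ c hc
    refine hmax U hU c fun Y hY => ?_
    rw [← inner_vec, map_sub]
    exact hc _ (Set.mem_image_of_mem vec hY)

theorem primalValue_eq {p : Mat n × Mat n} (hp : p ∈ primalSolutions C A b B P) :
    primalValue C A b B P = inner C p.1 :=
  IsLeast.csInf_eq ⟨⟨p, hp.1, rfl⟩, by rintro _ ⟨q, hq, rfl⟩; exact hp.2 q hq⟩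

namespace IsALMSequence

variable {σ : ℕ → ℝ} {r : ℕ → ℕ} {R : (k : ℕ) → Matrix (Fin n) (Fin (r k)) ℝ}
  {Y Z W : ℕ → Mat n}

theorem Y_mem (h : IsALMSequence A b B P σ r R Y Z W) (k : ℕ) : Y (k + 1) ∈ feasM A b B := by
  rw [h.Y_step]
  exact hat_mem_feasM (h.rank_pos k) (h.point_mem k)

theorem Z_mem (h : IsALMSequence A b B P σ r R Y Z W) (hP : IsClosedConvexCone P) (k : ℕ) :
    Z (k + 1) ∈ P := by
  rw [h.Z_step]
  exact vec.injective.mem_set_image.1 (hP.isConeProj_proj _).mem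

theorem W_succ_of_isSymm (h : IsALMSequence A b B P σ r R Y Z W) (hP : IsClosedConvexCone P)
    {k : ℕ} (hW : (W k).IsSymm) : W (k + 1) = multiplierStep P (σ k) (W k) (Y (k + 1)) := by
  rw [h.W_step, h.Z_step, multiplierStep_eq hP (h.penalty_pos k) hW (h.Y_mem k).1.1]

theorem W_mem (h : IsALMSequence A b B P σ r R Y Z W) (hP : IsClosedConvexCone P) (k : ℕ) :
    W k ∈ dualCone P := by
  induction k with
  | zero => exact h.multiplier_zero
  | succ k ih =>
    rw [h.W_succ_of_isSymm hP ih.1]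
    exact multiplierStep_mem (h.penalty_pos k)

theorem W_succ (h : IsALMSequence A b B P σ r R Y Z W) (hP : IsClosedConvexCone P) (k : ℕ) :
    W (k + 1) = multiplierStep P (σ k) (W k) (Y (k + 1)) :=
  h.W_succ_of_isSymm hP (h.W_mem hP k).1

theorem norm_Y_sub_Z (h : IsALMSequence A b B P σ r R Y Z W) (k : ℕ) :
    norm (Y (k + 1) - Z (k + 1)) = (1 / σ k) * norm (W (k + 1) - W k) := by
  have e : W (k + 1) - W k = -(σ k • (Y (k + 1) - Z (k + 1))) := by
    rw [h.W_step]
    abel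
  have hσ := h.penalty_pos k
  rw [e, ← norm_vec (-_), map_neg, norm_neg, norm_vec, norm_smul_of_nonneg hσ.le]
  field_simp

theorem tendsto_norm_Y_sub_Z (h : IsALMSequence A b B P σ r R Y Z W) {U : Mat n}
    (hU : Tendsto W atTop (𝓝 U)) : Tendsto (fun k => norm (Y k - Z k)) atTop (𝓝 0) := by
  rw [← tendsto_add_atTop_iff_nat 1]
  have hd : Tendsto (fun k => 1 / σ 0 * norm (W (k + 1) - W k)) atTop (𝓝 0) := by
    have h1 := (hU.comp (tendsto_add_atTop_nat 1)).sub hU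
    rw [sub_self] at h1
    have h2 := ((continuous_norm.tendsto _).comp h1).const_mul (1 / σ 0)
    rw [← norm_vec, map_zero, norm_zero, mul_zero] at h2
    exact h2
  refine squeeze_zero (fun k => Real.sqrt_nonneg _) (fun k => ?_) hd
  rw [h.norm_Y_sub_Z]
  exact mul_le_mul_of_nonneg_right
    (one_div_le_one_div_of_le (h.penalty_pos 0) (h.penalty_mono k.zero_le)) (Real.sqrt_nonneg _)

/-- The objective value of an iterate exceeds the optimal value by at most the subproblem error
and the decrease of the squared norm of the multiplier. -/
theorem inner_sub_primalValue_le (h : IsALMSequence A b B P σ r R Y Z W)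
    (hP : IsClosedConvexCone P) {p : Mat n × Mat n} (hp : p ∈ primalSolutions C A b B P) {k : ℕ}
    (hbdd : BddBelow ((fun Q => fR C P (σ k) (W k) Q) '' feasR A b B (r k)))
    (hrank : RankAdequate C A b B P (σ k) (W k) (r k)) :
    inner C (Y (k + 1)) - primalValue C A b B P ≤ subproblemGap C A b B P (σ k) (W k) (R k) +
      (1 / (2 * σ k)) * (norm (W k) ^ 2 - norm (W (k + 1)) ^ 2) := by
  have hσ := h.penalty_pos k
  obtain ⟨hpM, hpP, hpe⟩ := hp.1
  rw [← sub_eq_zero.1 hpe] at hpP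
  -- The primal solution serves as competitor: there `φ` is at most the optimal value plus `‖W k‖² /
  -- (2σ)`.
  have h1 := sInf_fR_le_phi (h.rank_pos k) hbdd hrank hpM
  have h2 := norm_multiplierStep_le (W := W k) hσ hpP
  have h3 : norm (multiplierStep P (σ k) (W k) p.1) ^ 2 / (2 * σ k) ≤
      norm (W k) ^ 2 / (2 * σ k) :=
    div_le_div_of_nonneg_right (pow_le_pow_left₀ (Real.sqrt_nonneg _) h2 2) (by positivity)
  rw [phi_eq hσ] at h1
  rw [primalValue_eq hp, subproblemGap, fR, ← h.Y_step, phi_eq hσ, ← h.W_succ hP]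
  have e : (1 / (2 * σ k)) * (norm (W k) ^ 2 - norm (W (k + 1)) ^ 2) =
      norm (W k) ^ 2 / (2 * σ k) - norm (W (k + 1)) ^ 2 / (2 * σ k) := by ring
  rw [e]
  linarith

theorem bounded (h : IsALMSequence A b B P σ r R Y Z W) (hP : IsClosedConvexCone P)
    {p : Mat n × Mat n} (hp : p ∈ primalSolutions C A b B P)
    (hb : IsBoundedPairs (primalSolutions C A b B P)) {c d : ℝ}
    (hc : ∀ k, norm (Y (k + 1) - Z (k + 1)) ≤ c) (hd : ∀ k, inner C (Y (k + 1)) ≤ d) :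
    IsBoundedPairs (Set.range fun k => (Y k, Z k)) := by
  obtain ⟨L, hL⟩ := hb
  obtain ⟨hpM, hpP, hpe⟩ := hp.1
  rw [← sub_eq_zero.1 hpe] at hpP
  obtain ⟨L', hL'⟩ := exists_norm_le_of_bounded_solutions (C := vec C) (L := L) (b := max c d)
    (y := fun k => vec (Y (k + 1))) (z := fun k => vec (Z (k + 1)))
    (isClosed_vec_image (isClosed_feasM (A := A) (b := b) (B := B)))
    (convex_vec_image convex_feasM) (isClosed_vec_image hP.isClosed) (convex_vec_image hP.convex)
    (Set.mem_image_of_mem vec hpM) (Set.mem_image_of_mem vec hpP)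
    (by
      rintro _ ⟨Q, hQ, rfl⟩ hQP hle
      rw [inner_vec, inner_vec] at hle
      rw [norm_vec]
      exact (hL (Q, Q) ⟨⟨hQ, vec.injective.mem_set_image.1 hQP, sub_self _⟩,
        fun q hq => hle.trans (hp.2 q hq)⟩).1)
    (fun k => Set.mem_image_of_mem vec (h.Y_mem k))
    (fun k => Set.mem_image_of_mem vec (h.Z_mem hP k))
    (fun k => by
      rw [← map_sub, norm_vec]
      exact (hc k).trans (le_max_left _ _))
    (fun k => by
      rw [inner_vec]
      exact (hd k).trans (le_max_right _ _))
  -- The pair of index `0` is arbitrary and needs its own bound; `Z` stays within `c` of `Y`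
  -- afterwards.
  refine ⟨max (max (norm (Y 0)) (norm (Z 0))) (max L' (L' + c)), ?_⟩
  rintro _ ⟨k, rfl⟩
  cases k with
  | zero => exact ⟨by simp, by simp⟩
  | succ k =>
    have h1 := hL' k
    have h2 := norm_sub_norm_le (vec (Z (k + 1))) (vec (Y (k + 1)))
    rw [norm_sub_rev, ← map_sub, norm_vec, norm_vec, norm_vec] at h2
    rw [norm_vec] at h1
    have h3 := hc k
    refine ⟨le_max_of_le_right (le_max_of_le_left h1), le_max_of_le_right (le_max_of_le_right ?_)⟩
    simp only
    linarith

theorem mem_primalSolutions_of_mapClusterPt (h : IsALMSequence A b B P σ r R Y Z W)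
    (hP : IsClosedConvexCone P) {p : Mat n × Mat n} (hp : p ∈ primalSolutions C A b B P)
    (hYZ : Tendsto (fun k => norm (Y k - Z k)) atTop (𝓝 0)) {e : ℕ → ℝ}
    (he : Tendsto e atTop (𝓝 0)) (hle : ∀ k, inner C (Y (k + 1)) ≤ inner C p.1 + e k)
    {q : Mat n × Mat n} (hq : MapClusterPt q atTop fun k => (Y k, Z k)) :
    q ∈ primalSolutions C A b B P := by
  rw [mapClusterPt_iff_ultrafilter] at hq
  obtain ⟨F, hF, hlim⟩ := hq
  have hY : Tendsto Y F (𝓝 q.1) := (continuous_fst.tendsto q).comp hlim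
  have hZ : Tendsto Z F (𝓝 q.2) := (continuous_snd.tendsto q).comp hlim
  have hpos : ∀ᶠ k in (F : Filter ℕ), ∃ j, k = j + 1 :=
    hF ((eventually_ge_atTop 1).mono fun k hk => ⟨k - 1, by omega⟩)
  refine ⟨⟨isClosed_feasM.mem_of_tendsto hY ?_, hP.isClosed.mem_of_tendsto hZ ?_, ?_⟩, ?_⟩
  · filter_upwards [hpos]
    rintro _ ⟨j, rfl⟩
    exact h.Y_mem j
  · filter_upwards [hpos]
    rintro _ ⟨j, rfl⟩
    exact h.Z_mem hP j
  · have := tendsto_nhds_unique ((continuous_norm.tendsto _).comp (hY.sub hZ)) (hYZ.mono_left hF)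
    rw [← norm_vec, norm_eq_zero] at this
    exact vec.injective (this.trans (map_zero vec).symm)
  · intro s hs
    refine le_trans ?_ (hp.2 s hs)
    -- The error `e j` belongs to the iterate `j + 1`; the value at `k = 0` is irrelevant along the
    -- ultrafilter.
    have he' : Tendsto (fun k => e (k - 1)) atTop (𝓝 0) := by
      rw [← tendsto_add_atTop_iff_nat 1]
      simpa using he
    have h1 : Tendsto (fun k => inner C p.1 + e (k - 1)) F (𝓝 (inner C p.1 + 0)) :=
      (he'.mono_left hF).const_add _
    rw [add_zero] at h1
    refine le_of_tendsto_of_tendsto (((continuous_inner_right C).tendsto _).comp hY) h1 ?_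
    filter_upwards [hpos]
    rintro _ ⟨j, rfl⟩
    exact hle j

/-- The multipliers converge to a dual solution. -/
theorem exists_tendsto_W (h : IsALMSequence A b B P σ r R Y Z W) (hP : IsClosedConvexCone P)
    {ε : ℕ → ℝ} (hC1 : CriterionC1 C A b B P σ ε r R W)
    (hbdd : ∀ k, BddBelow ((fun Q => fR C P (σ k) (W k) Q) '' feasR A b B (r k)))
    (hrank : ∀ k, RankAdequate C A b B P (σ k) (W k) (r k)) {γ : ℝ}
    (hne : ∃ U ∈ dualCone P, ∀ Y ∈ feasM A b B, γ ≤ inner (C - U) Y)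
    (hmax : ∀ U ∈ dualCone P, ∀ c : ℝ, (∀ Y ∈ feasM A b B, c ≤ inner (C - U) Y) → c ≤ γ) :
    ∃ U ∈ dualCone P, (∀ Y ∈ feasM A b B, γ ≤ inner (C - U) Y) ∧ Tendsto W atTop (𝓝 U) := by
  choose V hV hWV hstep using fun k => exists_exact_multiplier (h.penalty_pos k) (h.rank_pos k)
    (hbdd k) (hrank k) hmax (h.point_mem k) (hC1.tol_nonneg k) (hC1.gap_le k)
  obtain ⟨_, ⟨U, hU, rfl⟩, hUγ, hlim⟩ := tendsto_inexact_proximal_point (C := vec C)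
    (M := vec '' feasM A b B) (γ := γ)
    (isClosed_vec_image (isClosedConvexCone_dualCone P).isClosed) (W := fun k => vec (W k))
    (h.penalty_pos 0) (fun k => h.penalty_mono k.zero_le) hC1.tol_nonneg hC1.tol_summable hV
    (fun k => by
      rw [h.W_succ hP, h.Y_step]
      exact hWV k)
    (by
      obtain ⟨U, hU, hUγ⟩ := hne
      refine ⟨vec U, Set.mem_image_of_mem vec hU, ?_⟩
      rintro _ ⟨Y, hY, rfl⟩
      rw [← map_sub, inner_vec]
      exact hUγ Y hY)
    (fun U hU hUγ k => hstep k U hU hUγ)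
  refine ⟨U, hU, fun Y hY => ?_, ?_⟩
  · rw [← inner_vec, map_sub]
    exact hUγ _ (Set.mem_image_of_mem vec hY)
  · have h1 := (vec.symm.continuous.tendsto _).comp hlim
    rw [vec.symm_apply_apply] at h1
    exact h1.congr fun k => vec.symm_apply_apply _

end IsALMSequence

end ALM

end

/-! ### Assembly of the four assertions. -/

theorem mainTheorem8 {m n : ℕ} (C : ALM.Mat n) (hC : C.IsSymm)
    (A : Matrix (Fin m) (Fin n) ℝ) (b : Fin m → ℝ) (B : Finset (Fin n))
    (P : Set (ALM.Mat n)) (hP : ALM.IsPolyhedralCone P)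
    (hprimal : (ALM.primalSolutions C A b B P).Nonempty)
    (hdual : (ALM.dualSolutions C A b B P).Nonempty)
    (σ ε : ℕ → ℝ) (r : ℕ → ℕ) (R : (k : ℕ) → Matrix (Fin n) (Fin (r k)) ℝ)
    (Y Z W : ℕ → ALM.Mat n)
    (halm : ALM.IsALMSequence A b B P σ r R Y Z W)
    (hrank : ∀ k, ALM.RankAdequate C A b B P (σ k) (W k) (r k))
    (hC1 : ALM.CriterionC1 C A b B P σ ε r R W) :
    (∃ Wopt S₁ S₂ : ALM.Mat n, (Wopt, S₁, S₂) ∈ ALM.dualSolutions C A b B P ∧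
      Tendsto W atTop (𝓝 Wopt)) ∧
    (∀ k, ALM.norm (Y (k + 1) - Z (k + 1)) = (1 / σ k) * ALM.norm (W (k + 1) - W k)) ∧
    Tendsto (fun k => ALM.norm (Y k - Z k)) atTop (𝓝 0) ∧
    (∀ k, BddBelow ((fun R' => ALM.fR C P (σ k) (W k) R') '' ALM.feasR A b B (r k)) ∧
      ALM.inner C (Y (k + 1)) - ALM.primalValue C A b B P ≤
        ALM.subproblemGap C A b B P (σ k) (W k) (R k) +
          (1 / (2 * σ k)) * (ALM.norm (W k) ^ 2 - ALM.norm (W (k + 1)) ^ 2)) ∧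
    (ALM.IsBoundedPairs (ALM.primalSolutions C A b B P) →
      ALM.IsBoundedPairs (Set.range fun k => (Y k, Z k)) ∧
      ∀ p : ALM.Mat n × ALM.Mat n, MapClusterPt p atTop (fun k => (Y k, Z k)) →
        p ∈ ALM.primalSolutions C A b B P) := by
  have hPc := hP.isClosedConvexCone
  obtain ⟨p, hp⟩ := hprimal
  obtain ⟨γ, hne, hmax, hsol⟩ := ALM.exists_dual_value hC hPc ⟨p.1, hp.1.1⟩ hdual
  have hbdd : ∀ k, BddBelow ((fun R' => ALM.fR C P (σ k) (W k) R') '' ALM.feasR A b B (r k)) := by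
    obtain ⟨U, hU, hUγ⟩ := hne
    exact fun k => ALM.bddBelow_fR_image (halm.penalty_pos k) hU hUγ (halm.rank_pos k)
  obtain ⟨U, hU, hUγ, hW⟩ := halm.exists_tendsto_W hPc hC1 hbdd hrank hne hmax
  have hYZ := halm.tendsto_norm_Y_sub_Z hW
  have hval := fun k => halm.inner_sub_primalValue_le hPc hp (hbdd k) (hrank k)
  refine ⟨⟨U, _, _, hsol U hU hUγ, hW⟩, halm.norm_Y_sub_Z, hYZ, fun k => ⟨hbdd k, hval k⟩,
    fun hb => ?_⟩
  -- A majorant of the right side of the objective estimate: `σ k ≥ σ 0`, and the absolute value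
  -- makes the numerator nonnegative. It tends to zero because `W` converges.
  set e : ℕ → ℝ := fun k => (ε k ^ 2 + |ALM.norm (W k) ^ 2 - ALM.norm (W (k + 1)) ^ 2|) /
    (2 * σ 0) with he
  have he0 : Tendsto e atTop (𝓝 0) := by
    have h1 : Tendsto (fun k => ALM.norm (W k) ^ 2) atTop (𝓝 (ALM.norm U ^ 2)) :=
      ((ALM.continuous_norm.tendsto U).comp hW).pow 2
    have h2 := (h1.sub (h1.comp (tendsto_add_atTop_nat 1))).abs
    have h3 := ((hC1.tol_summable.tendsto_atTop_zero.pow 2).add h2).div_const (2 * σ 0)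
    simpa using h3
  have hle : ∀ k, ALM.inner C (Y (k + 1)) ≤ ALM.inner C p.1 + e k := by
    intro k
    have h1 := hval k
    rw [ALM.primalValue_eq hp] at h1
    have h2 := hC1.gap_le k
    have h3 : (ε k ^ 2 + |ALM.norm (W k) ^ 2 - ALM.norm (W (k + 1)) ^ 2|) / (2 * σ k) ≤ e k :=
      div_le_div_of_nonneg_left (by positivity) (by linarith [halm.penalty_pos 0])
        (by linarith [halm.penalty_mono k.zero_le])
    have h4 : (1 / (2 * σ k)) * (ALM.norm (W k) ^ 2 - ALM.norm (W (k + 1)) ^ 2) ≤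
        (1 / (2 * σ k)) * |ALM.norm (W k) ^ 2 - ALM.norm (W (k + 1)) ^ 2| :=
      mul_le_mul_of_nonneg_left (le_abs_self _)
        (one_div_nonneg.2 (by linarith [halm.penalty_pos k]))
    rw [add_div, div_eq_mul_one_div |_|, mul_comm |_|] at h3
    linarith
  obtain ⟨c, hc⟩ := hYZ.bddAbove_range
  obtain ⟨d, hd⟩ := he0.bddAbove_range
  exact ⟨halm.bounded hPc hp hb (fun k => hc ⟨k + 1, rfl⟩)
    (fun k => (hle k).trans (add_le_add_right (hd ⟨k, rfl⟩) _)),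
    fun q hq => halm.mem_primalSolutions_of_mapClusterPt hPc hp hYZ he0 hle hq⟩
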